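/- There is a polynomial-time algorithm (on a unit-cost random access machine with addition, subtraction and comparison, with running time bounded by a polynomial in the number $n$ of vertices) for the following problem. The input is a finite simple undirected graph $G$ given by its adjacency matrix, two vertices $s,t$ of $G$, and two minimum $s$-$t$-separators $A$ and $B$ of $G$. Here an $s$-$t$-separator is a set $S\subseteq V(G)\setminus\{s,t\}$ such that $s$ and $t$ lie in different components of $G-S$, and it is minimum if no $s$-$t$-separator has fewer elements. A sequence of token slides from $A$ to $B$ is a sequence $A=S_1,S_2,\dots,S_r=B$ ($r\ge 1$) of minimum $s$-$t$-separators such that for every $i\in\{2,\dots,r\}$ there are $v\in S_{i-1}$ and $u\in V(G)\setminus S_{i-1}$ adjacent to $v$ in $G$ with $S_i=(S_{i-1}\setminus\{v\})\cup\{u\}$. If a sequence of token slides from $A$ to $B$ exists, the algorithm outputs one with $r$ minimum; otherwise it reports that none exists. -/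

import Mathlib

/-! ### Minimum separators and token sliding -/

namespace TokenSliding

/-- `S` is an `s`-`t`-separator of `G`: neither `s` nor `t` lies in `S`, and `s` and `t` belong to
different components of `G - S`. -/
def IsSeparator {V : Type*} (G : SimpleGraph V) (s t : V) (S : Finset V) : Prop :=
  ∃ (hs : s ∉ S) (ht : t ∉ S), ¬ (G.induce {v | v ∉ S}).Reachable ⟨s, hs⟩ ⟨t, ht⟩

/-- `S` is an `s`-`t`-separator of minimum size. -/
def IsMinSeparator {V : Type*} (G : SimpleGraph V) (s t : V) (S : Finset V) : Prop :=
  IsSeparator G s t S ∧ ∀ T : Finset V, IsSeparator G s t T → S.card ≤ T.card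

/-- A token slide: one token of `S` moves from `v ∈ S` to a neighbour `u ∉ S` of `v`. -/
def IsSlide {V : Type*} [DecidableEq V] (G : SimpleGraph V) (S S' : Finset V) : Prop :=
  ∃ v ∈ S, ∃ u, u ∉ S ∧ G.Adj v u ∧ S' = insert u (S.erase v)

/-- A sequence `A = S₁, S₂, …, Sᵣ = B` (with `1 ≤ r`) of minimum `s`-`t`-separators in which each
set arises from the previous one by a token slide. -/
def IsSlideSequence {V : Type*} [DecidableEq V] (G : SimpleGraph V) (s t : V) (A B : Finset V)
    (L : List (Finset V)) : Prop :=
  L.head? = some A ∧ L.getLast? = some B ∧ (∀ S ∈ L, IsMinSeparator G s t S) ∧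
    L.IsChain (IsSlide G)

/-- A sequence of token slides from `A` to `B` of minimum length. -/
def IsShortestSlideSequence {V : Type*} [DecidableEq V] (G : SimpleGraph V) (s t : V)
    (A B : Finset V) (L : List (Finset V)) : Prop :=
  IsSlideSequence G s t A B L ∧ ∀ L', IsSlideSequence G s t A B L' → L.length ≤ L'.length

end TokenSliding

/-! ### Random access machines

The machine model is the unit-cost random access machine, programmed by structured programs. The
only arithmetic operations are addition, truncated subtraction and comparison. There is
no multiplication, so a number computed within `T` steps has only polynomially many bits in `T` and
in the size of the input, and polynomial time on this machine is polynomial time on a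
Turing machine. -/

namespace RAM

/-- The memory: number-valued variables, and number-valued arrays of unbounded length. A program
mentions only finitely many variables and arrays. -/
structure Memory where
  var : ℕ → ℕ
  arr : ℕ → ℕ → ℕ

/-- Expressions. `get a e` is the entry of array `a` at the address given by `e`. -/
inductive Expr where
  | lit (c : ℕ)
  | var (x : ℕ)
  | get (a : ℕ) (e : Expr)
  | add (e₁ e₂ : Expr)
  | sub (e₁ e₂ : Expr)
  | lt (e₁ e₂ : Expr)
  | eq (e₁ e₂ : Expr)

/-- The value of an expression; comparisons have value `1` (true) or `0` (false). -/
def Expr.eval (σ : Memory) : Expr → ℕ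
  | .lit c => c
  | .var x => σ.var x
  | .get a e => σ.arr a (e.eval σ)
  | .add e₁ e₂ => e₁.eval σ + e₂.eval σ
  | .sub e₁ e₂ => e₁.eval σ - e₂.eval σ
  | .lt e₁ e₂ => if e₁.eval σ < e₂.eval σ then 1 else 0
  | .eq e₁ e₂ => if e₁.eval σ = e₂.eval σ then 1 else 0

/-- The number of steps that evaluating an expression takes: one for each node. -/
def Expr.cost : Expr → ℕ
  | .lit _ => 1
  | .var _ => 1
  | .get _ e => e.cost + 1
  | .add e₁ e₂ => e₁.cost + e₂.cost + 1
  | .sub e₁ e₂ => e₁.cost + e₂.cost + 1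
  | .lt e₁ e₂ => e₁.cost + e₂.cost + 1
  | .eq e₁ e₂ => e₁.cost + e₂.cost + 1

/-- Programs. `assign x e` is `x := e`; `store a i e` is `a[i] := e`; `ite e P Q` runs `P` if `e` is
non-zero and `Q` otherwise; `loop e P` runs `P` as long as `e` is non-zero. -/
inductive Program where
  | skip
  | assign (x : ℕ) (e : Expr)
  | store (a : ℕ) (i e : Expr)
  | seq (P Q : Program)
  | ite (e : Expr) (P Q : Program)
  | loop (e : Expr) (P : Program)

def Memory.setVar (σ : Memory) (x v : ℕ) : Memory :=
  { σ with var := Function.update σ.var x v }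

def Memory.setArr (σ : Memory) (a i v : ℕ) : Memory :=
  { σ with arr := Function.update σ.arr a (Function.update (σ.arr a) i v) }

/-- `Exec P σ T τ`: started in memory `σ`, the program `P` halts after exactly `T` steps
with memory `τ`. (For given `P` and `σ` there is at most one such pair `T`, `τ`.) -/
inductive Exec : Program → Memory → ℕ → Memory → Prop
  | skip (σ : Memory) : Exec .skip σ 1 σ
  | assign (σ : Memory) (x : ℕ) (e : Expr) :
      Exec (.assign x e) σ (e.cost + 1) (σ.setVar x (e.eval σ))
  | store (σ : Memory) (a : ℕ) (i e : Expr) :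
      Exec (.store a i e) σ (i.cost + e.cost + 1) (σ.setArr a (i.eval σ) (e.eval σ))
  | seq {P Q : Program} {σ τ υ : Memory} {T U : ℕ} (hP : Exec P σ T τ) (hQ : Exec Q τ U υ) :
      Exec (.seq P Q) σ (T + U) υ
  | ite_true {e : Expr} {P Q : Program} {σ τ : Memory} {T : ℕ} (he : e.eval σ ≠ 0)
      (hP : Exec P σ T τ) : Exec (.ite e P Q) σ (e.cost + 1 + T) τ
  | ite_false {e : Expr} {P Q : Program} {σ τ : Memory} {T : ℕ} (he : e.eval σ = 0)
      (hQ : Exec Q σ T τ) : Exec (.ite e P Q) σ (e.cost + 1 + T) τ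
  | loop_true {e : Expr} {P : Program} {σ τ υ : Memory} {T U : ℕ} (he : e.eval σ ≠ 0)
      (hP : Exec P σ T τ) (hL : Exec (.loop e P) τ U υ) :
      Exec (.loop e P) σ (e.cost + 1 + T + U) υ
  | loop_false {e : Expr} {P : Program} {σ : Memory} (he : e.eval σ = 0) :
      Exec (.loop e P) σ (e.cost + 1) σ

end RAM

/-! ### Input and output of a program for token sliding -/

namespace TokenSliding

open Classical in
/-- The memory that holds the instance `(G, s, t, A, B)`, where `G` is a graph on the vertices
`0, …, n - 1`. Variables `0`, `1`, `2` hold `n`, `s`, `t`; array `0` holds the adjacency matrix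
of `G`, row by row; arrays `1` and `2` hold the indicator vectors of `A` and `B`; all the rest of
the memory is `0`. -/
noncomputable def inputMemory {n : ℕ} (G : SimpleGraph (Fin n)) (s t : Fin n)
    (A B : Finset (Fin n)) : RAM.Memory where
  var x := if x = 0 then n else if x = 1 then s else if x = 2 then t else 0
  arr a m :=
    if a = 0 then (if ∃ u v : Fin n, m = u * n + v ∧ G.Adj u v then 1 else 0)
    else if a = 1 then (if ∃ v ∈ A, m = v then 1 else 0)
    else if a = 2 then (if ∃ v ∈ B, m = v then 1 else 0)
    else 0

/-- The program answers "there is a sequence" by leaving `1` in variable `3`. -/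
def OutputYes (σ : RAM.Memory) : Prop := σ.var 3 = 1

/-- The program answers "there is no sequence" by leaving `0` in variable `3`. -/
def OutputNo (σ : RAM.Memory) : Prop := σ.var 3 = 0

/-- The sequence of subsets of `{0, …, n - 1}` that the program leaves in memory: variable `4` holds
the number of its members, and array `3` holds their indicator vectors, each of length `n`, one
after the other. -/
def outputSequence (n : ℕ) (σ : RAM.Memory) : List (Finset (Fin n)) :=
  List.ofFn fun i : Fin (σ.var 4) =>
    Finset.univ.filter fun v : Fin n => σ.arr 3 (i * n + v) = 1

end TokenSliding

/-! Write C(S) for the component of s in G - S. A minimum separator S is the boundary of C(S), and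
by submodularity of vertex boundaries the sets that contain s, avoid t and have a minimum separator
as boundary are closed under intersection and union (`IsTight.submodular`). Let S' arise from S by a
slide from v to u with u outside C(S). Then C(S) ⊆ C(S'), and uncrossing shows that v is the only
vertex gained that belongs to any minimum separator (`MinSlide.eq_of_mem_component`). Hence R(S),
the set of vertices of C(S) lying in some minimum separator, changes by exactly one element in every
slide, in either direction, and |R(S) Δ R(B)| is a lower bound for the number of slides from S to B
(`IsSlideSequence.slideDist_lt_length`).

The bound is attained greedily. Suppose B ≠ A is reachable from A and C(B) is not contained in C(A).
Some step of a given sequence first brings a vertex of A ∩ C(B) to the side of s; this vertex is the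
sliding token v itself, and uncrossing shows that the same slide can already be made in A
(`exists_slide_of_not_subset`). If C(B) ⊆ C(A), the argument applies with s and t exchanged
(`exists_isTowards`). Such a slide lowers the distance by exactly one, and B stays reachable because
slides are reversible. The distance is at most n, so n greedy rounds reach B whenever it is
reachable.

All loops of the program run from 0 to n - 1, so its running time is polynomial by its syntax alone
(`WellFormed.exists_exec`); its correctness follows from invariants (`loop_invariant`). -/

namespace TokenSliding

set_option linter.unusedSectionVars false

/-! ### Components, boundaries and uncrossing of minimum separators -/

section Components

variable {V : Type*} [Fintype V] [DecidableEq V] (G : SimpleGraph V)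

open Classical in
/-- The vertices of the component of `s` in `G - S` (empty if `s ∈ S`). -/
noncomputable def component (S : Finset V) (s : V) : Finset V :=
  Finset.univ.filter fun v => ∃ (hs : s ∉ S) (hv : v ∉ S),
    (G.induce {v | v ∉ S}).Reachable ⟨s, hs⟩ ⟨v, hv⟩

open Classical in
/-- The outer vertex boundary of `X`. -/
noncomputable def boundary (X : Finset V) : Finset V :=
  Finset.univ.filter fun v => v ∉ X ∧ ∃ x ∈ X, G.Adj x v

variable {G} {S S' T X Y A B : Finset V} {s t u v w : V}

theorem mem_component : v ∈ component G S s ↔ ∃ (hs : s ∉ S) (hv : v ∉ S),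
    (G.induce {v | v ∉ S}).Reachable ⟨s, hs⟩ ⟨v, hv⟩ := by
  simp [component]

theorem mem_boundary : v ∈ boundary G X ↔ v ∉ X ∧ ∃ x ∈ X, G.Adj x v := by
  simp [boundary]

theorem self_mem_component (hs : s ∉ S) : s ∈ component G S s :=
  mem_component.2 ⟨hs, hs, .refl _⟩

theorem notMem_of_mem_component (hv : v ∈ component G S s) : v ∉ S :=
  (mem_component.1 hv).2.1

theorem mem_component_of_adj (hv : v ∈ component G S s) (h : G.Adj v u) (hu : u ∉ S) :
    u ∈ component G S s := by
  obtain ⟨hs, hv', hr⟩ := mem_component.1 hv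
  refine mem_component.2 ⟨hs, hu, hr.trans (SimpleGraph.Adj.reachable ?_)⟩
  simpa using h

theorem component_induction {p : V → Prop} (hs : p s)
    (h : ∀ x y, x ∈ component G S s → p x → G.Adj x y → y ∉ S → p y)
    (hv : v ∈ component G S s) : p v := by
  obtain ⟨hs', hv', ⟨q⟩⟩ := mem_component.1 hv
  suffices H : ∀ (a b : {v | v ∉ S}) (q : (G.induce {v | v ∉ S}).Walk a b),
      a.1 ∈ component G S s → p a.1 → p b.1 from
    H _ _ q (self_mem_component hs') hs
  intro a b q
  induction q with
  | nil => exact fun _ h => h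
  | @cons a b c hab q ih =>
    intro ha hpa
    have hab' : G.Adj a.1 b.1 := by simpa using hab
    exact ih (mem_component_of_adj ha hab' b.2) (h _ _ ha hpa hab' b.2)

theorem component_subset_component (hs : s ∉ S') (h : ∀ x ∈ component G S s, x ∉ S') :
    component G S s ⊆ component G S' s := fun v hv => by
  refine (component_induction (p := fun x => x ∈ component G S' s) (self_mem_component hs)
    (fun x y hx hx' hxy hy => ?_) hv)
  exact mem_component_of_adj hx' hxy (h y (mem_component_of_adj hx hxy hy))

theorem isSeparator_iff : IsSeparator G s t S ↔ s ∉ S ∧ t ∉ S ∧ t ∉ component G S s := by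
  constructor
  · rintro ⟨hs, ht, h⟩
    exact ⟨hs, ht, fun h' => h (mem_component.1 h').2.2⟩
  · rintro ⟨hs, ht, h⟩
    exact ⟨hs, ht, fun h' => h (mem_component.2 ⟨hs, ht, h'⟩)⟩

theorem IsSeparator.symm (h : IsSeparator G s t S) : IsSeparator G t s S := by
  obtain ⟨hs, ht, h⟩ := h
  exact ⟨ht, hs, fun h' => h h'.symm⟩

theorem IsMinSeparator.symm (h : IsMinSeparator G s t S) : IsMinSeparator G t s S :=
  ⟨h.1.symm, fun T hT => h.2 T hT.symm⟩

theorem disjoint_component_of_isSeparator (h : IsSeparator G s t S)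
    (hv : v ∈ component G S s) : v ∉ component G S t := by
  obtain ⟨hs, ht, h⟩ := h
  intro hv'
  exact h ((mem_component.1 hv).2.2.trans (mem_component.1 hv').2.2.symm)

theorem isSeparator_boundary (hs : s ∈ X) (ht : t ∉ X) (ht' : t ∉ boundary G X) :
    IsSeparator G s t (boundary G X) := by
  refine isSeparator_iff.2 ⟨fun h => (mem_boundary.1 h).1 hs, ht', fun h => ht ?_⟩
  refine component_induction (p := fun x => x ∈ X) hs (fun x y _ hx hxy hy => ?_) h
  by_contra hyX
  exact hy (mem_boundary.2 ⟨hyX, x, hx, hxy⟩)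

theorem boundary_component_subset : boundary G (component G S s) ⊆ S := fun v hv => by
  obtain ⟨hv, x, hx, hxv⟩ := mem_boundary.1 hv
  by_contra h
  exact hv (mem_component_of_adj hx hxv h)

/-- The boundary is itself a separator and is contained in S, so minimality forces equality. -/
theorem IsMinSeparator.boundary_component (h : IsMinSeparator G s t S) :
    boundary G (component G S s) = S := by
  obtain ⟨hs, ht, hst⟩ := isSeparator_iff.1 h.1
  refine Finset.eq_of_subset_of_card_le boundary_component_subset (h.2 _ ?_)
  exact isSeparator_boundary (self_mem_component hs) hst fun h => ht (boundary_component_subset h)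

theorem IsMinSeparator.card_eq (hS : IsMinSeparator G s t S) (hT : IsMinSeparator G s t T) :
    S.card = T.card :=
  le_antisymm (hS.2 _ hT.1) (hT.2 _ hS.1)

theorem IsMinSeparator.of_card_eq (hS : IsMinSeparator G s t S) (hT : IsSeparator G s t T)
    (h : T.card = S.card) : IsMinSeparator G s t T :=
  ⟨hT, fun U hU => h ▸ hS.2 U hU⟩

theorem IsMinSeparator.exists_adj (hS : IsMinSeparator G s t S) (hv : v ∈ S) :
    ∃ x ∈ component G S s, G.Adj x v :=
  (mem_boundary.1 (hS.boundary_component.symm.subset hv)).2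

/-- `X` contains `s`, does not contain `t`, and its boundary is a minimum `s`-`t`-separator. -/
def IsTight (G : SimpleGraph V) (s t : V) (X : Finset V) : Prop :=
  s ∈ X ∧ t ∉ X ∧ IsMinSeparator G s t (boundary G X)

theorem IsMinSeparator.isTight (hS : IsMinSeparator G s t S) : IsTight G s t (component G S s) := by
  obtain ⟨hs, ht, hst⟩ := isSeparator_iff.1 hS.1
  exact ⟨self_mem_component hs, hst, by rwa [hS.boundary_component]⟩

theorem boundary_inter_union_boundary_union_subset :
    boundary G (X ∩ Y) ∪ boundary G (X ∪ Y) ⊆ boundary G X ∪ boundary G Y := by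
  intro v
  simp only [Finset.mem_union, mem_boundary, Finset.mem_inter]
  grind

theorem boundary_inter_inter_boundary_union_subset :
    boundary G (X ∩ Y) ∩ boundary G (X ∪ Y) ⊆ boundary G X ∩ boundary G Y := by
  intro v
  simp only [Finset.mem_union, mem_boundary, Finset.mem_inter]
  grind

/-- Both new boundaries are separators, so each has at least the minimum size k. Their union and
intersection are contained in those of the old boundaries, so their sizes add up to at most 2k;
equality holds throughout. -/
theorem IsTight.submodular (hX : IsTight G s t X) (hY : IsTight G s t Y) :
    IsTight G s t (X ∩ Y) ∧ IsTight G s t (X ∪ Y) ∧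
      boundary G (X ∩ Y) ∪ boundary G (X ∪ Y) = boundary G X ∪ boundary G Y := by
  obtain ⟨hsX, htX, hX⟩ := hX
  obtain ⟨hsY, htY, hY⟩ := hY
  have hU := boundary_inter_union_boundary_union_subset (G := G) (X := X) (Y := Y)
  have hI := boundary_inter_inter_boundary_union_subset (G := G) (X := X) (Y := Y)
  have ht : t ∉ boundary G X ∪ boundary G Y := by
    simp [(isSeparator_iff.1 hX.1).2.1, (isSeparator_iff.1 hY.1).2.1]
  have hi : IsSeparator G s t (boundary G (X ∩ Y)) :=
    isSeparator_boundary (by simp [*]) (by simp [*])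
      fun h => ht (hU (Finset.mem_union_left _ h))
  have hu : IsSeparator G s t (boundary G (X ∪ Y)) :=
    isSeparator_boundary (by simp [*]) (by simp [*])
      fun h => ht (hU (Finset.mem_union_right _ h))
  have h1 := hX.2 _ hi
  have h2 := hX.2 _ hu
  have h3 := hX.card_eq hY
  have h4 := Finset.card_union_add_card_inter (boundary G (X ∩ Y)) (boundary G (X ∪ Y))
  have h5 := Finset.card_union_add_card_inter (boundary G X) (boundary G Y)
  have h6 := Finset.card_le_card hU
  have h7 := Finset.card_le_card hI
  refine ⟨⟨by simp [*], by simp [*], hX.of_card_eq hi (by omega)⟩,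
    ⟨by simp [*], by simp [*], hX.of_card_eq hu (by omega)⟩,
    Finset.eq_of_subset_of_card_le hU (by omega)⟩

theorem IsTight.mem_boundary_inter (hX : IsTight G s t X) (hY : IsTight G s t Y)
    (hw : w ∈ boundary G X) (hwY : w ∈ Y) : w ∈ boundary G (X ∩ Y) := by
  have h : w ∈ boundary G (X ∩ Y) ∪ boundary G (X ∪ Y) := by
    rw [(hX.submodular hY).2.2]
    exact Finset.mem_union_left _ hw
  refine (Finset.mem_union.1 h).resolve_right fun h' => (mem_boundary.1 h').1 ?_
  exact Finset.mem_union_right _ hwY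

end Components

/-! ### The effect of one slide, and the distance to the target -/

section Slides

variable {V : Type*} [Fintype V] [DecidableEq V] {G : SimpleGraph V}
  {S S' T W X Y A B : Finset V} {s t u v w : V}

theorem card_insert_erase (hv : v ∈ S) (hu : u ∉ S) : (insert u (S.erase v)).card = S.card := by
  rw [Finset.card_insert_of_notMem (by simp [hu]), Finset.card_erase_add_one hv]

theorem eq_insert_erase_of_insert_erase (hv : v ∈ S) (hu : u ∉ S)
    (h : S' = insert u (S.erase v)) : S = insert v (S'.erase u) := by
  subst h
  ext x
  simp only [Finset.mem_insert, Finset.mem_erase]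
  grind

theorem IsSlide.symm (h : IsSlide G S S') : IsSlide G S' S := by
  obtain ⟨v, hv, u, hu, huv, h⟩ := h
  refine ⟨u, by simp [h], v, ?_, huv.symm, eq_insert_erase_of_insert_erase hv hu h⟩
  subst h
  simp [huv.ne]

/-- The data of a token slide from `v` to `u` between two minimum separators. -/
structure MinSlide (G : SimpleGraph V) (s t v u : V) (S S' : Finset V) : Prop where
  left : IsMinSeparator G s t S
  right : IsMinSeparator G s t S'
  mem : v ∈ S
  notMem : u ∉ S
  adj : G.Adj v u
  eq : S' = insert u (S.erase v)

namespace MinSlide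

variable (h : MinSlide G s t v u S S')
include h

theorem mem_right : u ∈ S' := by simp [h.eq]

theorem notMem_right : v ∉ S' := by simp [h.eq, h.adj.ne]

theorem reverse : MinSlide G s t u v S' S :=
  ⟨h.right, h.left, h.mem_right, h.notMem_right, h.adj.symm,
    eq_insert_erase_of_insert_erase h.mem h.notMem h.eq⟩

theorem swap : MinSlide G t s v u S S' :=
  ⟨h.left.symm, h.right.symm, h.mem, h.notMem, h.adj, h.eq⟩

theorem component_subset (hu : u ∉ component G S s) :
    component G S s ⊆ component G S' s := by
  refine component_subset_component (isSeparator_iff.1 h.right.1).1 fun x hx hx' => ?_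
  rw [h.eq, Finset.mem_insert, Finset.mem_erase] at hx'
  rcases hx' with rfl | hx'
  · exact hu hx
  · exact notMem_of_mem_component hx hx'.2

theorem mem_component (hu : u ∉ component G S s) : v ∈ component G S' s := by
  obtain ⟨x, hx, hxv⟩ := h.left.exists_adj h.mem
  exact mem_component_of_adj (h.component_subset hu hx) hxv h.notMem_right

/-- Otherwise the union of the two sides contains both u and v, and its boundary is a separator
inside S without v. Thus the reverse of a slide towards s is a slide away from s. -/
theorem notMem_component (hu : u ∈ component G S s) : v ∉ component G S' s := by
  intro hv
  have hk := h.left.2 _ (h.left.isTight.submodular h.right.isTight).2.1.2.2.1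
  have hsub : boundary G (component G S s ∪ component G S' s) ⊆ S.erase v := by
    intro x hx
    have hx' := boundary_inter_union_boundary_union_subset (Finset.mem_union_right _ hx)
    rw [h.left.boundary_component, h.right.boundary_component, h.eq] at hx'
    have hx := (mem_boundary.1 hx).1
    simp only [Finset.mem_union, Finset.mem_insert, Finset.mem_erase, not_or] at hx hx' ⊢
    grind
  have := Finset.card_le_card hsub
  have := Finset.card_erase_add_one h.mem
  omega

/-- Uncross to Z = C(S) ∪ (C(W) ∩ C(S')), a tight set inside C(S'). Its boundary contains w and S
without v. If w ≠ v, these already make up the whole boundary, so v lies in Z; then its neighbour u,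
which is outside C(S'), would be a further boundary vertex. -/
theorem eq_of_mem_component (hu : u ∉ component G S s) (hW : IsMinSeparator G s t W) (hwW : w ∈ W)
    (hw : w ∈ component G S' s) (hw' : w ∉ component G S s) : w = v := by
  by_contra hne
  have hwS : w ∉ S := fun hwS => notMem_of_mem_component hw (by simp [h.eq, hne, hwS])
  have hZ := (h.left.isTight.submodular (hW.isTight.submodular h.right.isTight).1).2.1
  set Z := component G S s ∪ component G W s ∩ component G S' s with hZdef
  have hZS' : Z ⊆ component G S' s :=
    Finset.union_subset (h.component_subset hu) Finset.inter_subset_right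
  have hwZ : w ∈ boundary G Z := by
    obtain ⟨hwn, x, hx, hxw⟩ := mem_boundary.1 (hW.isTight.mem_boundary_inter h.right.isTight
      (by rwa [hW.boundary_component]) hw)
    refine mem_boundary.2 ⟨?_, x, Finset.mem_union_right _ hx, hxw⟩
    rw [hZdef, Finset.mem_union]
    exact not_or.2 ⟨hw', hwn⟩
  have hSZ : ∀ x ∈ S, x ∉ Z → x ∈ boundary G Z := fun x hx hxZ => by
    obtain ⟨y, hy, hyx⟩ := h.left.exists_adj hx
    exact mem_boundary.2 ⟨hxZ, y, Finset.mem_union_left _ hy, hyx⟩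
  have hsub : insert w (S.erase v) ⊆ boundary G Z := by
    refine Finset.insert_subset hwZ fun x hx => ?_
    obtain ⟨hxv, hx⟩ := Finset.mem_erase.1 hx
    exact hSZ x hx fun hxZ => notMem_of_mem_component (hZS' hxZ) (by simp [h.eq, hx, hxv])
  have heq := Finset.eq_of_subset_of_card_le hsub (by
    rw [card_insert_erase h.mem hwS, hZ.2.2.card_eq h.left])
  have hvZ : v ∈ Z := by
    by_contra hvZ
    have := hSZ v h.mem hvZ
    rw [← heq] at this
    simp [Ne.symm hne] at this
  have huS' : u ∉ component G S' s := fun hu' => notMem_of_mem_component hu' h.mem_right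
  have huZ : u ∈ boundary G Z := mem_boundary.2 ⟨fun hu => huS' (hZS' hu), v, hvZ, h.adj⟩
  rw [← heq, Finset.mem_insert, Finset.mem_erase] at huZ
  rcases huZ with rfl | huZ
  · exact huS' hw
  · exact h.notMem huZ.2

/-- If `v` also belongs to `A`, then a slide away from `s` leaves the side of `s` in `G - A`. -/
theorem notMem_of_mem (hu : u ∉ component G S s) (hA : IsMinSeparator G s t A) (hv : v ∈ A) :
    u ∉ component G A s ∧ u ∉ A := by
  have hk := (h.left.2 _ (h.right.isTight.submodular hA.isTight).2.1.2.2.1)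
  have hk' := (h.left.isTight.submodular hA.isTight).2.1.2.2.card_eq h.left
  have hvS := h.mem_component hu
  have hsub' := h.component_subset hu
  -- If u were in C(A) or A, passing from C(S) ∪ C(A) to C(S') ∪ C(A) would lose v from the boundary
  -- and gain nothing, leaving a separator that is too small.
  by_contra hcon
  have hsub : boundary G (component G S' s ∪ component G A s) ⊆
      (boundary G (component G S s ∪ component G A s)).erase v := by
    intro x hx
    have hx' := boundary_inter_union_boundary_union_subset (Finset.mem_union_right _ hx)
    rw [h.right.boundary_component, hA.boundary_component] at hx'
    have hxn := (mem_boundary.1 hx).1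
    simp only [Finset.mem_union, not_or] at hxn hx'
    have hxv : x ≠ v := fun e => hxn.1 (e ▸ hvS)
    refine Finset.mem_erase.2 ⟨hxv, mem_boundary.2 ⟨?_, ?_⟩⟩
    · rw [Finset.mem_union, not_or]
      exact ⟨fun h => hxn.1 (hsub' h), hxn.2⟩
    · by_cases hxA : x ∈ A
      · obtain ⟨y, hy, hyx⟩ := hA.exists_adj hxA
        exact ⟨y, Finset.mem_union_right _ hy, hyx⟩
      · have hxS : x ∈ S := by
          have := hx'.resolve_right hxA
          rw [h.eq, Finset.mem_insert, Finset.mem_erase] at this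
          rcases this with rfl | h'
          · exact absurd ⟨hxn.2, hxA⟩ hcon
          · exact h'.2
        obtain ⟨y, hy, hyx⟩ := h.left.exists_adj hxS
        exact ⟨y, Finset.mem_union_left _ hy, hyx⟩
  have hvB : v ∈ boundary G (component G S s ∪ component G A s) := by
    obtain ⟨y, hy, hyx⟩ := h.left.exists_adj h.mem
    refine mem_boundary.2 ⟨?_, y, Finset.mem_union_left _ hy, hyx⟩
    rw [Finset.mem_union, not_or]
    exact ⟨fun h' => notMem_of_mem_component h' h.mem, fun h' => notMem_of_mem_component h' hv⟩
  have h1 := Finset.card_le_card hsub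
  have h2 := Finset.card_erase_add_one hvB
  omega

end MinSlide

open Classical in
/-- The vertices on the side of `s` in `G - S` that belong to some minimum separator. -/
noncomputable def relevantSide (G : SimpleGraph V) (s t : V) (S : Finset V) : Finset V :=
  (component G S s).filter fun w => ∃ W, IsMinSeparator G s t W ∧ w ∈ W

theorem mem_relevantSide : w ∈ relevantSide G s t S ↔
    w ∈ component G S s ∧ ∃ W, IsMinSeparator G s t W ∧ w ∈ W := by
  simp [relevantSide]

/-- The side of s may gain many vertices, but only v among them lies in a minimum separator. This is
why distances are measured on relevant vertices only. -/
theorem MinSlide.relevantSide_eq (h : MinSlide G s t v u S S') (hu : u ∉ component G S s) :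
    v ∉ relevantSide G s t S ∧ relevantSide G s t S' = insert v (relevantSide G s t S) := by
  refine ⟨fun hv => notMem_of_mem_component (mem_relevantSide.1 hv).1 h.mem, ?_⟩
  ext w
  rw [Finset.mem_insert, mem_relevantSide, mem_relevantSide]
  constructor
  · rintro ⟨hw, W, hW, hwW⟩
    by_cases hw' : w ∈ component G S s
    · exact .inr ⟨hw', W, hW, hwW⟩
    · exact .inl (h.eq_of_mem_component hu hW hwW hw hw')
  · rintro (rfl | ⟨hw, W, hW, hwW⟩)
    · exact ⟨h.mem_component hu, S, h.left, h.mem⟩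
    · exact ⟨h.component_subset hu hw, W, hW, hwW⟩

/-- The number of slides that a shortest sequence from `S` to `B` takes, if there is one. -/
noncomputable def slideDist (G : SimpleGraph V) (s t : V) (S B : Finset V) : ℕ :=
  (symmDiff (relevantSide G s t S) (relevantSide G s t B)).card

theorem slideDist_self : slideDist G s t B B = 0 := by simp [slideDist]

theorem slideDist_le_card : slideDist G s t S B ≤ Fintype.card V := Finset.card_le_univ _

theorem card_symmDiff_insert {P Q : Finset V} (hv : v ∉ P) :
    ((symmDiff (insert v P) Q).card + 1 = (symmDiff P Q).card ∧ v ∈ Q) ∨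
      ((symmDiff (insert v P) Q).card = (symmDiff P Q).card + 1 ∧ v ∉ Q) := by
  by_cases hQ : v ∈ Q
  · left
    have : symmDiff (insert v P) Q = (symmDiff P Q).erase v := by
      ext x
      simp only [Finset.mem_symmDiff, Finset.mem_insert, Finset.mem_erase]
      grind
    rw [this]
    exact ⟨Finset.card_erase_add_one (by simp [Finset.mem_symmDiff, hv, hQ]), hQ⟩
  · right
    have : symmDiff (insert v P) Q = insert v (symmDiff P Q) := by
      ext x
      simp only [Finset.mem_symmDiff, Finset.mem_insert]
      grind
    rw [this]
    exact ⟨Finset.card_insert_of_notMem (by simp [Finset.mem_symmDiff, hv, hQ]), hQ⟩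

theorem MinSlide.slideDist_le (h : MinSlide G s t v u S S') :
    slideDist G s t S B ≤ slideDist G s t S' B + 1 := by
  unfold slideDist
  by_cases hu : u ∈ component G S s
  · obtain ⟨h1, h2⟩ := h.reverse.relevantSide_eq (h.notMem_component hu)
    rw [h2]
    have := card_symmDiff_insert (Q := relevantSide G s t B) h1
    omega
  · obtain ⟨h1, h2⟩ := h.relevantSide_eq hu
    rw [h2]
    have := card_symmDiff_insert (Q := relevantSide G s t B) h1
    omega

/-- Sliding a token from `v` to `u` moves it towards `B`. -/
def IsTowards (G : SimpleGraph V) (s : V) (S B : Finset V) (v u : V) : Prop :=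
  v ∈ S ∧ u ∉ S ∧ G.Adj v u ∧ v ∉ B ∧ (v ∈ component G B s ↔ u ∉ component G S s)

theorem MinSlide.slideDist_eq (h : MinSlide G s t v u S S')
    (hvu : IsTowards G s S B v u) : slideDist G s t S B = slideDist G s t S' B + 1 := by
  obtain ⟨-, -, -, hvB, hiff⟩ := hvu
  unfold slideDist
  by_cases hu : u ∈ component G S s
  · obtain ⟨h1, h2⟩ := h.reverse.relevantSide_eq (h.notMem_component hu)
    rw [h2]
    have := card_symmDiff_insert (Q := relevantSide G s t B) h1
    -- Otherwise v, a neighbour of u outside B, would be on the side of s in G - B, which the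
    -- direction of the slide excludes.
    have huB : u ∉ relevantSide G s t B := fun h' => by
      have h' := (mem_relevantSide.1 h').1
      exact (hiff.not.2 (not_not.2 hu)) (mem_component_of_adj h' h.adj.symm hvB)
    grind
  · obtain ⟨h1, h2⟩ := h.relevantSide_eq hu
    rw [h2]
    have := card_symmDiff_insert (Q := relevantSide G s t B) h1
    have hvB : v ∈ relevantSide G s t B := mem_relevantSide.2 ⟨hiff.2 hu, S, h.left, h.mem⟩
    grind

end Slides

/-! ### Sequences of slides: the lower bound and the greedy step -/

section Sequences

variable {V : Type*} [DecidableEq V] {G : SimpleGraph V}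
  {S S' A B : Finset V} {s t : V} {L : List (Finset V)}

theorem isSlideSequence_singleton (hA : IsMinSeparator G s t A) :
    IsSlideSequence G s t A A [A] := by
  simp [IsSlideSequence, hA]

theorem IsSlideSequence.concat (h : IsSlideSequence G s t A S L) (hS : IsSlide G S S')
    (hS' : IsMinSeparator G s t S') : IsSlideSequence G s t A S' (L ++ [S']) := by
  obtain ⟨h1, h2, h3, h4⟩ := h
  refine ⟨by simp [h1], by simp, by grind, ?_⟩
  rw [List.isChain_append]
  refine ⟨h4, .singleton _, ?_⟩
  simpa [h2] using hS

theorem IsSlideSequence.cons (h : IsSlideSequence G s t S' B L) (hS : IsSlide G S S')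
    (hS' : IsMinSeparator G s t S) : IsSlideSequence G s t S B (S :: L) := by
  obtain ⟨h1, h2, h3, h4⟩ := h
  refine ⟨by simp, by simp [List.getLast?_cons, h2], by grind, ?_⟩
  rw [List.isChain_cons]
  exact ⟨by simpa [h1] using hS, h4⟩

/-- A discrete crossing argument: a property that holds at the start of a chain and fails at its end
is lost in a single step. -/
theorem exists_isChain_step {α : Type*} {R : α → α → Prop} (p q : α → Prop) :
    ∀ (L : List α) (a b : α), L.head? = some a → L.getLast? = some b → L.IsChain R →
      (∀ x ∈ L, q x) → p a → ¬ p b → ∃ x y, q x ∧ q y ∧ R x y ∧ p x ∧ ¬ p y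
  | [], _, _, h, _, _, _, _, _ => by simp at h
  | [x], a, b, ha, hb, _, _, hpa, hpb => by
    simp at ha hb
    subst ha hb
    exact absurd hpa hpb
  | x :: y :: L, a, b, ha, hb, hc, hq, hpa, hpb => by
    simp only [List.head?_cons, Option.some.injEq] at ha
    subst ha
    rw [List.isChain_cons_cons] at hc
    by_cases hy : p y
    · exact exists_isChain_step p q (y :: L) y b rfl (by simpa using hb) hc.2
        (fun z hz => hq z (List.mem_cons_of_mem _ hz)) hy hpb
    · exact ⟨x, y, hq _ (by simp), hq _ (by simp), hc.1, hpa, hy⟩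

variable [Fintype V]

/-- Each slide changes the distance by at most one. The inequality is strict since the length counts
sets, one more than the slides. -/
theorem IsSlideSequence.slideDist_lt_length (h : IsSlideSequence G s t A B L) :
    slideDist G s t A B < L.length := by
  induction L generalizing A with
  | nil => simp [IsSlideSequence] at h
  | cons S L ih =>
    obtain ⟨h1, h2, h3, h4⟩ := h
    simp only [List.head?_cons, Option.some.injEq] at h1
    subst h1
    cases L with
    | nil =>
      simp only [List.getLast?_singleton, Option.some.injEq] at h2
      subst h2
      simp [slideDist_self]
    | cons S' L =>
      rw [List.isChain_cons_cons] at h4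
      have hlt := ih (A := S') ⟨rfl, by simpa using h2,
        fun T hT => h3 T (List.mem_cons_of_mem _ hT), h4.2⟩
      obtain ⟨v, hv, u, hu, hvu, he⟩ := h4.1
      have hle : slideDist G s t S B ≤ _ :=
        (MinSlide.mk (h3 S (by simp)) (h3 S' (by simp)) hv hu hvu he).slideDist_le
      simp only [List.length_cons] at hlt ⊢
      omega

theorem exists_slide_of_not_subset (hA : IsMinSeparator G s t A) (hB : IsMinSeparator G s t B)
    (h : ∃ L, IsSlideSequence G s t A B L) (hAB : ¬ component G B s ⊆ component G A s) :
    ∃ v u, MinSlide G s t v u A (insert u (A.erase v)) ∧ u ∉ component G A s ∧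
      v ∈ component G B s := by
  obtain ⟨L, h1, h2, h3, h4⟩ := h
  obtain ⟨a, haA, haB⟩ : ∃ a ∈ A, a ∈ component G B s := by
    by_contra! hcon
    exact hAB (component_subset_component (isSeparator_iff.1 hA.1).1 fun x hx hxA => hcon x hxA hx)
  -- The property followed along the sequence: no vertex of A ∩ C(B) has yet come to the side of s.
  -- It holds at A and fails at B.
  obtain ⟨S, S', hS, hS', ⟨v, hv, u, hu, hvu, he⟩, hp, hq⟩ := exists_isChain_step
    (fun S => ∀ a ∈ A, a ∈ component G B s → a ∉ component G S s) _ L A B h1 h2 h4 h3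
    (fun a ha _ ha' => notMem_of_mem_component ha' ha) (fun h => h a haA haB haB)
  have hm : MinSlide G s t v u S S' := ⟨hS, hS', hv, hu, hvu, he⟩
  push Not at hq
  obtain ⟨w, hwA, hwB, hwS'⟩ := hq
  have huS : u ∉ component G S s := fun hu => by
    have hv := hm.notMem_component hu
    exact hp w hwA hwB (hm.reverse.component_subset hv hwS')
  obtain rfl := hm.eq_of_mem_component huS hA hwA hwS' (hp w hwA hwB)
  obtain ⟨huA, huA'⟩ := hm.notMem_of_mem huS hA hwA
  refine ⟨w, u, ⟨hA, ?_, hwA, huA', hvu, rfl⟩, huA, hwB⟩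
  -- The slide found in S is transplanted to A: the boundary of the tight set C(A) ∪ (C(S') ∩ C(B))
  -- turns out to be A with w replaced by u. Other vertices of A stay outside this set, since w is
  -- the only relevant vertex that C(S') gains over C(S).
  have hZ := (hA.isTight.submodular (hS'.isTight.submodular hB.isTight).1).2.1
  set Z := component G A s ∪ component G S' s ∩ component G B s
  have hsub : insert u (A.erase w) ⊆ boundary G Z := by
    refine Finset.insert_subset (mem_boundary.2 ⟨?_, w, ?_, hvu⟩) fun x hx => ?_
    · simp only [Z, Finset.mem_union, Finset.mem_inter, not_or, not_and]
      exact ⟨huA, fun h' => absurd hm.mem_right (notMem_of_mem_component h')⟩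
    · exact Finset.mem_union_right _ (Finset.mem_inter.2 ⟨hwS', hwB⟩)
    · obtain ⟨hxw, hx⟩ := Finset.mem_erase.1 hx
      obtain ⟨y, hy, hyx⟩ := hA.exists_adj hx
      refine mem_boundary.2 ⟨?_, y, Finset.mem_union_left _ hy, hyx⟩
      simp only [Z, Finset.mem_union, Finset.mem_inter, not_or, not_and]
      exact ⟨fun h' => notMem_of_mem_component h' hx, fun h' hxB =>
        hxw (hm.eq_of_mem_component huS hA hx h' (hp x hx hxB))⟩
  rw [Finset.eq_of_subset_of_card_le hsub
    (by rw [card_insert_erase hwA huA', hZ.2.2.card_eq hA])]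
  exact hZ.2.2

/-- If both sides of B were contained in those of A, a vertex of B outside A would connect s to t in
G - A, so B = A. Hence a slide exists away from s or away from t. -/
theorem exists_isTowards (hA : IsMinSeparator G s t A) (hB : IsMinSeparator G s t B)
    (h : ∃ L, IsSlideSequence G s t A B L) (hAB : A ≠ B) :
    ∃ v u, IsTowards G s A B v u ∧ IsSeparator G s t (insert u (A.erase v)) := by
  by_cases h1 : component G B s ⊆ component G A s
  · by_cases h2 : component G B t ⊆ component G A t
    · refine absurd (Finset.eq_of_subset_of_card_le (fun b hb => ?_) (hA.card_eq hB).le) hAB.symm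
      by_contra hbA
      obtain ⟨x, hx, hxb⟩ := hB.exists_adj hb
      obtain ⟨y, hy, hyb⟩ := hB.symm.exists_adj hb
      exact disjoint_component_of_isSeparator hA.1 (mem_component_of_adj (h1 hx) hxb hbA)
        (mem_component_of_adj (h2 hy) hyb hbA)
    · obtain ⟨L, h1', h2', h3', h4'⟩ := h
      obtain ⟨v, u, hm, hu, hv⟩ := exists_slide_of_not_subset hA.symm hB.symm
        ⟨L, h1', h2', fun S hS => (h3' S hS).symm, h4'⟩ h2
      refine ⟨v, u, ⟨hm.mem, hm.notMem, hm.adj, notMem_of_mem_component hv, ?_⟩, hm.right.symm.1⟩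
      have hvB := disjoint_component_of_isSeparator hB.symm.1 hv
      -- A slide that is away from both s and t would leave v on both sides of the new separator.
      have huA : u ∈ component G A s := by
        by_contra huA
        exact disjoint_component_of_isSeparator hm.right.1 (hm.mem_component hu)
          (hm.swap.mem_component huA)
      simp [hvB, huA]
  · obtain ⟨v, u, hm, hu, hv⟩ := exists_slide_of_not_subset hA hB h h1
    exact ⟨v, u, ⟨hm.mem, hm.notMem, hm.adj, notMem_of_mem_component hv, by simp [hu, hv]⟩,
      hm.right.1⟩

end Sequences

end TokenSliding

namespace RAM

/-! ### Programs whose loops are counted -/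

@[simp] theorem Memory.setVar_var_self (σ : Memory) (x v : ℕ) : (σ.setVar x v).var x = v := by
  simp [Memory.setVar]

theorem Memory.setVar_var (σ : Memory) (x v y : ℕ) :
    (σ.setVar x v).var y = if y = x then v else σ.var y := by
  simp [Memory.setVar, Function.update_apply]

@[simp] theorem Memory.setVar_arr (σ : Memory) (x v : ℕ) : (σ.setVar x v).arr = σ.arr := rfl

@[simp] theorem Memory.setArr_var (σ : Memory) (a i v : ℕ) : (σ.setArr a i v).var = σ.var := rfl

theorem Memory.setArr_arr (σ : Memory) (a i v b : ℕ) : (σ.setArr a i v).arr b =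
    if b = a then Function.update (σ.arr a) i v else σ.arr b := by
  simp [Memory.setArr, Function.update_apply]

@[simp] theorem Memory.setArr_arr_self (σ : Memory) (a i v : ℕ) :
    (σ.setArr a i v).arr a = Function.update (σ.arr a) i v := by
  simp [Memory.setArr]

/-- Programs in which every loop runs a variable from `0` to the value of variable `0`. -/
inductive ForProgram where
  | skip
  | assign (x : ℕ) (e : Expr)
  | store (a : ℕ) (i e : Expr)
  | seq (P Q : ForProgram)
  | ite (e : Expr) (P Q : ForProgram)
  | loop (x : ℕ) (P : ForProgram)

namespace ForProgram

def compile : ForProgram → Program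
  | skip => .skip
  | assign x e => .assign x e
  | store a i e => .store a i e
  | seq P Q => .seq P.compile Q.compile
  | ite e P Q => .ite e P.compile Q.compile
  | loop x P => .seq (.assign x (.lit 0)) (.loop (.lt (.var x) (.var 0))
      (.seq P.compile (.assign x (.add (.var x) (.lit 1)))))

/-- The memory after a run of the program. -/
def run : ForProgram → Memory → Memory
  | skip, σ => σ
  | assign x e, σ => σ.setVar x (e.eval σ)
  | store a i e, σ => σ.setArr a (i.eval σ) (e.eval σ)
  | seq P Q, σ => Q.run (P.run σ)
  | ite e P Q, σ => if e.eval σ ≠ 0 then P.run σ else Q.run σ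
  -- The number of rounds is fixed on entry. This agrees with the compiled test because a
  -- well-formed body writes neither variable `0` nor the counter.
  | loop x P, σ =>
      (fun τ => (P.run τ).setVar x ((P.run τ).var x + 1))^[σ.var 0] (σ.setVar x 0)

def writtenVars : ForProgram → List ℕ
  | skip => []
  | assign x _ => [x]
  | store _ _ _ => []
  | seq P Q => P.writtenVars ++ Q.writtenVars
  | ite _ P Q => P.writtenVars ++ Q.writtenVars
  | loop x P => x :: P.writtenVars

def writtenArrs : ForProgram → List ℕ
  | skip => []
  | assign _ _ => []
  | store a _ _ => [a]
  | seq P Q => P.writtenArrs ++ Q.writtenArrs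
  | ite _ P Q => P.writtenArrs ++ Q.writtenArrs
  | loop _ P => P.writtenArrs

/-- Variable `0` is never written, and the body of a loop does not write the loop variable. -/
def WellFormed : ForProgram → Prop
  | skip => True
  | assign x _ => x ≠ 0
  | store _ _ _ => True
  | seq P Q => P.WellFormed ∧ Q.WellFormed
  | ite _ P Q => P.WellFormed ∧ Q.WellFormed
  | loop x P => x ≠ 0 ∧ x ∉ P.writtenVars ∧ P.WellFormed

theorem run_var_eq {P : ForProgram} {σ : Memory} {x : ℕ} (hx : x ∉ P.writtenVars) :
    (P.run σ).var x = σ.var x := by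
  induction P generalizing σ with
  | skip => rfl
  | assign y e => simp_all [run, writtenVars, Memory.setVar_var]
  | store a i e => rfl
  | seq P Q ihP ihQ =>
    simp only [writtenVars, List.mem_append, not_or] at hx
    rw [run, ihQ hx.2, ihP hx.1]
  | ite e P Q ihP ihQ =>
    simp only [writtenVars, List.mem_append, not_or] at hx
    rw [run]
    split
    · exact ihP hx.1
    · exact ihQ hx.2
  | loop y P ih =>
    simp only [writtenVars, List.mem_cons, not_or] at hx
    rw [run]
    generalize σ.var 0 = k
    have : σ.var x = (σ.setVar y 0).var x := by simp [Memory.setVar_var, hx.1]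
    rw [this]
    generalize σ.setVar y 0 = τ
    induction k generalizing τ with
    | zero => rfl
    | succ k ihk =>
      rw [Function.iterate_succ_apply', Memory.setVar_var, if_neg hx.1, ih hx.2, ihk]

theorem run_arr_eq {P : ForProgram} {σ : Memory} {a : ℕ} (ha : a ∉ P.writtenArrs) :
    (P.run σ).arr a = σ.arr a := by
  induction P generalizing σ with
  | skip => rfl
  | assign y e => rfl
  | store b i e => simp_all [run, writtenArrs, Memory.setArr_arr]
  | seq P Q ihP ihQ =>
    simp only [writtenArrs, List.mem_append, not_or] at ha
    rw [run, ihQ ha.2, ihP ha.1]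
  | ite e P Q ihP ihQ =>
    simp only [writtenArrs, List.mem_append, not_or] at ha
    rw [run]
    split
    · exact ihP ha.1
    · exact ihQ ha.2
  | loop y P ih =>
    rw [run]
    generalize σ.var 0 = k
    have : σ.arr a = (σ.setVar y 0).arr a := rfl
    rw [this]
    generalize σ.setVar y 0 = τ
    induction k generalizing τ with
    | zero => rfl
    | succ k ihk =>
      rw [Function.iterate_succ_apply', Memory.setVar_arr, ih ha, ihk]

theorem WellFormed.zero_notMem {P : ForProgram} (h : P.WellFormed) : 0 ∉ P.writtenVars := by
  induction P with
  | skip => simp [writtenVars]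
  | assign y e => simpa [writtenVars, eq_comm (a := 0)] using (show y ≠ 0 from h)
  | store b i e => simp [writtenVars]
  | seq P Q ihP ihQ => simpa [writtenVars] using ⟨ihP h.1, ihQ h.2⟩
  | ite e P Q ihP ihQ => simpa [writtenVars] using ⟨ihP h.1, ihQ h.2⟩
  | loop y P ih => simpa [writtenVars, eq_comm] using ⟨h.1, ih h.2.2⟩

/-- A well-formed program halts within polynomially many steps in the value of variable `0`. -/
theorem WellFormed.exists_exec {P : ForProgram} (h : P.WellFormed) : ∃ p : Polynomial ℕ,
    ∀ σ : Memory, ∃ T, T ≤ p.eval (σ.var 0) ∧ Exec P.compile σ T (P.run σ) := by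
  induction P with
  | skip => exact ⟨1, fun σ => ⟨1, by simp, .skip σ⟩⟩
  | assign x e => exact ⟨.C (e.cost + 1), fun σ => ⟨_, by simp, .assign σ x e⟩⟩
  | store a i e => exact ⟨.C (i.cost + e.cost + 1), fun σ => ⟨_, by simp, .store σ a i e⟩⟩
  | seq P Q ihP ihQ =>
    obtain ⟨p, hp⟩ := ihP h.1
    obtain ⟨q, hq⟩ := ihQ h.2
    refine ⟨p + q, fun σ => ?_⟩
    obtain ⟨T, hT, hP⟩ := hp σ
    obtain ⟨U, hU, hQ⟩ := hq (P.run σ)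
    rw [run_var_eq h.1.zero_notMem] at hU
    exact ⟨T + U, by simpa using Nat.add_le_add hT hU, .seq hP hQ⟩
  | ite e P Q ihP ihQ =>
    obtain ⟨p, hp⟩ := ihP h.1
    obtain ⟨q, hq⟩ := ihQ h.2
    refine ⟨.C (e.cost + 1) + p + q, fun σ => ?_⟩
    simp only [Polynomial.eval_add, Polynomial.eval_C]
    by_cases he : e.eval σ = 0
    · obtain ⟨T, hT, hQ⟩ := hq σ
      exact ⟨e.cost + 1 + T, by omega, by simpa [run, compile, he] using Exec.ite_false he hQ⟩
    · obtain ⟨T, hT, hP⟩ := hp σ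
      exact ⟨e.cost + 1 + T, by omega, by simpa [run, compile, he] using Exec.ite_true he hP⟩
  | loop x P ih =>
    obtain ⟨hx0, hx, hP⟩ := h
    obtain ⟨p, hp⟩ := ih hP
    -- Induction on the number k of remaining rounds. Each round costs 4 for the test and 4 for the
    -- increment besides the body; the failing last test costs 4, and initialising the counter adds
    -- 2 below.
    have key : ∀ k (τ : Memory), τ.var x + k = τ.var 0 → ∃ T, T ≤ k * (p.eval (τ.var 0) + 8) + 4 ∧
        Exec (.loop (.lt (.var x) (.var 0))
          (.seq P.compile (.assign x (.add (.var x) (.lit 1))))) τ T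
          ((fun τ => (P.run τ).setVar x ((P.run τ).var x + 1))^[k] τ) := by
      intro k
      induction k with
      | zero =>
        intro τ hτ
        have he : (Expr.lt (.var x) (.var 0)).eval τ = 0 := by
          rw [Expr.eval, if_neg (by simp only [Expr.eval]; omega)]
        exact ⟨_, by simp [Expr.cost], .loop_false he⟩
      | succ k ihk =>
        intro τ hτ
        obtain ⟨T, hT, hPe⟩ := hp τ
        have h0 : ((P.run τ).setVar x ((P.run τ).var x + 1)).var 0 = τ.var 0 := by
          rw [Memory.setVar_var, if_neg (Ne.symm hx0), run_var_eq hP.zero_notMem]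
        obtain ⟨U, hU, hL⟩ := ihk ((P.run τ).setVar x ((P.run τ).var x + 1)) (by
          rw [h0, Memory.setVar_var_self, run_var_eq hx]
          omega)
        have he : (Expr.lt (.var x) (.var 0)).eval τ ≠ 0 := by
          rw [Expr.eval, if_pos (by simp only [Expr.eval]; omega)]
          exact one_ne_zero
        refine ⟨_, ?_, .loop_true he (.seq hPe (.assign _ _ _)) hL⟩
        rw [h0] at hU
        simp only [Expr.cost, Nat.succ_mul]
        omega
    refine ⟨.X * (p + .C 8) + .C 6, fun σ => ?_⟩
    obtain ⟨T, hT, hE⟩ := key (σ.var 0) (σ.setVar x 0) (by simp [Memory.setVar_var, hx0.symm])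
    refine ⟨_, ?_, .seq (.assign _ _ _) hE⟩
    simp only [Memory.setVar_var, if_neg (Ne.symm hx0)] at hT
    simp only [Expr.cost, Polynomial.eval_add, Polynomial.eval_mul, Polynomial.eval_X,
      Polynomial.eval_C]
    omega

/-! ### Frame conditions and loop invariants -/

/-- Memories that agree except on the variables and arrays that `P` writes. -/
def Frame (P : ForProgram) (σ τ : Memory) : Prop :=
  (∀ x, x ∉ P.writtenVars → τ.var x = σ.var x) ∧ ∀ a, a ∉ P.writtenArrs → τ.arr a = σ.arr a

theorem frame_run (P : ForProgram) (σ : Memory) : P.Frame σ (P.run σ) :=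
  ⟨fun _ h => run_var_eq h, fun _ h => run_arr_eq h⟩

theorem run_seq (P Q : ForProgram) (σ : Memory) : (seq P Q).run σ = Q.run (P.run σ) := rfl

/-- The step may use the value of the counter and the frame relative to the entry memory, so an
invariant only has to describe what the loop changes. -/
theorem loop_invariant {x : ℕ} {P : ForProgram} {σ : Memory} (hwf : (loop x P).WellFormed)
    (I : ℕ → Memory → Prop) (h0 : I 0 (σ.setVar x 0))
    (hstep : ∀ i τ, i < σ.var 0 → τ.var x = i → (loop x P).Frame σ τ → I i τ →
      I (i + 1) ((P.run τ).setVar x (i + 1))) :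
    I (σ.var 0) ((loop x P).run σ) := by
  obtain ⟨hx0, hx, hP⟩ := hwf
  suffices H : ∀ k ≤ σ.var 0, ∀ τ,
      τ = (fun τ => (P.run τ).setVar x ((P.run τ).var x + 1))^[k] (σ.setVar x 0) →
      τ.var x = k ∧ (loop x P).Frame σ τ ∧ I k τ from (H _ le_rfl _ rfl).2.2
  intro k
  induction k with
  | zero =>
    rintro - τ rfl
    refine ⟨by simp, ⟨fun y hy => ?_, fun a _ => rfl⟩, h0⟩
    simp only [writtenVars, List.mem_cons, not_or] at hy
    simp [Memory.setVar_var, hy.1]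
  | succ k ih =>
    intro hk τ hτ
    rw [Function.iterate_succ_apply'] at hτ
    obtain ⟨h1, h2, h3⟩ := ih (by omega) _ rfl
    generalize (fun τ => (P.run τ).setVar x ((P.run τ).var x + 1))^[k] (σ.setVar x 0) = υ at *
    have hv : (P.run υ).var x = k := by rw [run_var_eq hx, h1]
    rw [hv] at hτ
    subst hτ
    refine ⟨by simp, ⟨fun y hy => ?_, fun a ha => ?_⟩, hstep k υ (by omega) h1 h2 h3⟩
    · have hy' := hy
      simp only [writtenVars, List.mem_cons, not_or] at hy'
      rw [Memory.setVar_var, if_neg hy'.1, run_var_eq hy'.2, h2.1 y hy]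
    · rw [Memory.setVar_arr, ← h2.2 a ha]
      exact run_arr_eq ha

/-- Run `P` if all the expressions are non-zero. -/
def whenAll : List Expr → ForProgram → ForProgram
  | [], P => P
  | e :: es, P => ite e (whenAll es P) skip

open Classical in
theorem run_whenAll (es : List Expr) (P : ForProgram) (σ : Memory) :
    (whenAll es P).run σ = if ∀ e ∈ es, e.eval σ ≠ 0 then P.run σ else σ := by
  induction es with
  | nil => simp [whenAll]
  | cons e es ih =>
    by_cases he : e.eval σ = 0
    · simp [whenAll, run, he]
    · simp [whenAll, run, he, ih]

@[simp] theorem writtenVars_whenAll (es : List Expr) (P : ForProgram) :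
    (whenAll es P).writtenVars = P.writtenVars := by
  induction es with
  | nil => rfl
  | cons e es ih => simp [whenAll, writtenVars, ih]

@[simp] theorem writtenArrs_whenAll (es : List Expr) (P : ForProgram) :
    (whenAll es P).writtenArrs = P.writtenArrs := by
  induction es with
  | nil => rfl
  | cons e es ih => simp [whenAll, writtenArrs, ih]

@[simp] theorem wellFormed_whenAll (es : List Expr) (P : ForProgram) :
    (whenAll es P).WellFormed ↔ P.WellFormed := by
  induction es with
  | nil => rfl
  | cons e es ih => simp [whenAll, WellFormed, ih]

end ForProgram

end RAM

namespace TokenSliding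

open RAM RAM.ForProgram

/-! ### The program -/

/-- The subset of `{0, …, n - 1}` whose indicator vector is `f`. -/
def indicatedSet (n : ℕ) (f : ℕ → ℕ) : Finset (Fin n) := Finset.univ.filter fun v => f v ≠ 0

/-- The entry of the adjacency matrix in the row given by variable `x` and the column given by
variable `y`; array `4` holds the addresses of the rows. -/
def adjExpr (x y : ℕ) : Expr := .get 0 (.add (.get 4 (.var x)) (.var y))

def negExpr (e : Expr) : Expr := .eq e (.lit 0)

/-- Store the multiples of variable `0` in array `4`. -/
def buildRows : ForProgram :=
  .seq (.loop 5 (.seq (.store 4 (.var 5) (.var 6)) (.assign 6 (.add (.var 6) (.var 0)))))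
    -- The multiple with index n is needed as well: the output may have n + 1 members.
    (.store 4 (.var 0) (.var 6))

/-- If variable `7` is marked in array `m`, mark its neighbour variable `8` unless it is in `a`. -/
def markNeighbor (a m : ℕ) : ForProgram :=
  whenAll [.get m (.var 7), adjExpr 7 8, negExpr (.get a (.var 8))] (.store m (.var 8) (.lit 1))

def markNeighbors (a m : ℕ) : ForProgram := .loop 7 (.loop 8 (markNeighbor a m))

/-- Mark in array `m` the component of `s` after deletion of the set in array `a`. -/
def markComponent (a m : ℕ) : ForProgram :=
  .seq (.loop 5 (.store m (.var 5) (.lit 0)))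
    (.seq (.store m (.var 1) (.lit 1)) (.loop 6 (markNeighbors a m)))

/-- Copy the current set from array `1` to array `7`. -/
def copySet : ForProgram := .loop 5 (.store 7 (.var 5) (.get 1 (.var 5)))

/-- Record the slide from variable `9` to variable `10` if it leads to a separator. -/
def testSlide : ForProgram :=
  .seq (.seq copySet (.seq (.store 7 (.var 9) (.lit 0)) (.store 7 (.var 10) (.lit 1))))
    (.seq (markComponent 7 8) (whenAll [negExpr (.get 8 (.var 2))]
      (.seq (.assign 12 (.lit 1)) (.seq (.assign 13 (.var 9)) (.assign 14 (.var 10))))))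

/-- Test the slide from variable `9` to variable `10` if it moves a token towards the target. -/
def trySlide : ForProgram :=
  whenAll [.get 1 (.var 9), negExpr (.get 1 (.var 10)), adjExpr 9 10, negExpr (.get 2 (.var 9)),
    .eq (.lt (.lit 0) (.get 5 (.var 9))) (negExpr (.get 6 (.var 10))),
    negExpr (.eq (.var 10) (.var 1)), negExpr (.eq (.var 10) (.var 2))] testSlide

def searchSlide : ForProgram :=
  .seq (.assign 12 (.lit 0)) (.loop 9 (.loop 10 trySlide))

/-- Append the current set to the output. -/
def appendOutput : ForProgram :=
  .seq (.loop 5 (.store 3 (.add (.get 4 (.var 4)) (.var 5)) (.lt (.lit 0) (.get 1 (.var 5)))))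
    (.assign 4 (.add (.var 4) (.lit 1)))

/-- Perform a slide towards the target, if there is one. -/
def slideOnce : ForProgram :=
  .seq (markComponent 1 6) (.seq searchSlide (whenAll [.var 12]
    (.seq (.seq (.store 1 (.var 13) (.lit 0)) (.store 1 (.var 14) (.lit 1))) appendOutput)))

/-- Decide whether the current set is contained in the target. -/
def decideDone : ForProgram :=
  .seq (.assign 3 (.lit 1))
    (.loop 5 (whenAll [.get 1 (.var 5), negExpr (.get 2 (.var 5))] (.assign 3 (.lit 0))))

def slidingProgram : ForProgram :=
  .seq buildRows (.seq (markComponent 2 5) (.seq appendOutput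
    (.seq (.loop 11 slideOnce) decideDone)))

theorem slidingProgram_wellFormed : slidingProgram.WellFormed := by
  simp [slidingProgram, WellFormed, buildRows, markComponent, markNeighbors, markNeighbor,
    appendOutput, slideOnce, decideDone, searchSlide, trySlide, testSlide, copySet, writtenVars]

/-! ### Its correctness -/

variable {n : ℕ} {G : SimpleGraph (Fin n)} {s t u v : Fin n} {S A B : Finset (Fin n)}
  {σ τ : Memory} {a m : ℕ} {f g : ℕ → ℕ}

theorem mem_indicatedSet : v ∈ indicatedSet n f ↔ f v ≠ 0 := by simp [indicatedSet]

theorem indicatedSet_congr (h : ∀ i < n, f i = g i) : indicatedSet n f = indicatedSet n g := by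
  ext v
  rw [mem_indicatedSet, mem_indicatedSet, h v v.2]

theorem indicatedSet_update_zero :
    indicatedSet n (Function.update f v 0) = (indicatedSet n f).erase v := by
  ext w
  by_cases h : w = v <;> simp [mem_indicatedSet, h, Fin.val_inj]

theorem indicatedSet_update_one :
    indicatedSet n (Function.update f v 1) = insert v (indicatedSet n f) := by
  ext w
  by_cases h : w = v <;> simp [mem_indicatedSet, h, Fin.val_inj]

/-- The memory holds the graph, the two terminals and the addresses of the rows. -/
structure Holds (G : SimpleGraph (Fin n)) (s t : Fin n) (σ : Memory) : Prop where
  size : σ.var 0 = n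
  source : σ.var 1 = s
  target : σ.var 2 = t
  adj : ∀ u v : Fin n, σ.arr 0 (u * n + v) ≠ 0 ↔ G.Adj u v
  rows : ∀ i ≤ n, σ.arr 4 i = i * n

theorem Holds.of_eq (h : Holds G s t σ) (h0 : τ.var 0 = σ.var 0) (h1 : τ.var 1 = σ.var 1)
    (h2 : τ.var 2 = σ.var 2) (h3 : τ.arr 0 = σ.arr 0) (h4 : τ.arr 4 = σ.arr 4) :
    Holds G s t τ :=
  ⟨h0.trans h.size, h1.trans h.source, h2.trans h.target, fun u v => by rw [h3, h.adj],
    fun i hi => by rw [h4, h.rows i hi]⟩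

theorem Holds.frame {P : ForProgram} (h : Holds G s t σ) (hF : P.Frame σ τ)
    (hv : 0 ∉ P.writtenVars ∧ 1 ∉ P.writtenVars ∧ 2 ∉ P.writtenVars)
    (ha : 0 ∉ P.writtenArrs ∧ 4 ∉ P.writtenArrs) : Holds G s t τ :=
  h.of_eq (hF.1 _ hv.1) (hF.1 _ hv.2.1) (hF.1 _ hv.2.2) (hF.2 _ ha.1) (hF.2 _ ha.2)

theorem Holds.eval_adjExpr (h : Holds G s t σ) {x y : ℕ} (hx : σ.var x = u) (hy : σ.var y = v) :
    (adjExpr x y).eval σ ≠ 0 ↔ G.Adj u v := by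
  rw [← h.adj u v]
  simp [adjExpr, Expr.eval, hx, hy, h.rows u u.2.le]

theorem eval_negExpr {e : Expr} : (negExpr e).eval σ ≠ 0 ↔ e.eval σ = 0 := by
  by_cases h : e.eval σ = 0 <;> simp [negExpr, Expr.eval, h]

/-! ### Marking a component -/

open Classical in
theorem markNeighbor_run (h : Holds G s t σ) (hu : σ.var 7 = u) (hv : σ.var 8 = v) :
    indicatedSet n (((markNeighbor a m).run σ).arr m) =
      if u ∈ indicatedSet n (σ.arr m) ∧ G.Adj u v ∧ v ∉ indicatedSet n (σ.arr a) then
        insert v (indicatedSet n (σ.arr m)) else indicatedSet n (σ.arr m) := by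
  rw [markNeighbor, run_whenAll]
  simp only [List.forall_mem_cons, List.not_mem_nil, false_imp_iff, implies_true, and_true,
    h.eval_adjExpr hu hv, eval_negExpr, mem_indicatedSet, not_not]
  simp only [Expr.eval, hu, hv]
  split_ifs with h1
  · simp [run, Expr.eval, hv, indicatedSet_update_one]
  · rfl

theorem writtenVars_markNeighbors : (markNeighbors a m).writtenVars = [7, 8] := rfl

theorem writtenArrs_markNeighbors : (markNeighbors a m).writtenArrs = [m] := rfl

/-- Vertices marked during a pass may mark others in the same pass, so the result is only
sandwiched: it contains the old marks and their allowed neighbours, and lies in every closed set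
containing the old marks. -/
theorem markNeighbors_run (h : Holds G s t σ) (ham : a ≠ m) (h0 : m ≠ 0) (h4 : m ≠ 4) :
    indicatedSet n (σ.arr m) ⊆ indicatedSet n (((markNeighbors a m).run σ).arr m) ∧
    (∀ u ∈ indicatedSet n (σ.arr m), ∀ v, G.Adj u v → v ∉ indicatedSet n (σ.arr a) →
      v ∈ indicatedSet n (((markNeighbors a m).run σ).arr m)) ∧
    ∀ C, indicatedSet n (σ.arr m) ⊆ C →
      (∀ u ∈ C, ∀ v, G.Adj u v → v ∉ indicatedSet n (σ.arr a) → v ∈ C) →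
      indicatedSet n (((markNeighbors a m).run σ).arr m) ⊆ C := by
  set M := indicatedSet n (σ.arr m) with hM
  set A := indicatedSet n (σ.arr a) with hA
  let I : ℕ → ℕ → Memory → Prop := fun i j τ =>
    M ⊆ indicatedSet n (τ.arr m) ∧
    (∀ u ∈ M, ∀ v : Fin n, u < i ∨ (u = i ∧ v < j) → G.Adj u v → v ∉ A →
      v ∈ indicatedSet n (τ.arr m)) ∧
    ∀ C, M ⊆ C → (∀ u ∈ C, ∀ v, G.Adj u v → v ∉ A → v ∈ C) → indicatedSet n (τ.arr m) ⊆ C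
  have hI : I (σ.var 0) 0 ((markNeighbors a m).run σ) := by
    refine loop_invariant (x := 7) (by simp [WellFormed, writtenVars, markNeighbor])
      (fun i => I i 0) ⟨subset_rfl, by simp, fun C hC _ => hC⟩ ?_
    intro i τ hi hτi hF hIτ
    have hτ : Holds G s t τ := h.frame hF (by simp [writtenVars, markNeighbor])
      (by simp [writtenArrs, markNeighbor, h0.symm, h4.symm])
    have hτa : τ.arr a = σ.arr a := hF.2 a (by simp [writtenArrs, markNeighbor, ham])
    have hin : I i (τ.var 0) ((loop 8 (markNeighbor a m)).run τ) := by
      refine loop_invariant (x := 8) (by simp [WellFormed, writtenVars, markNeighbor])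
        (fun j => I i j) hIτ ?_
      rintro j υ hj hυj hF' ⟨hI1, hI2, hI3⟩
      have hυ : Holds G s t υ := hτ.frame hF' (by simp [writtenVars, markNeighbor])
        (by simp [writtenArrs, markNeighbor, h0.symm, h4.symm])
      have hυa : υ.arr a = σ.arr a :=
        (hF'.2 a (by simp [writtenArrs, markNeighbor, ham])).trans hτa
      have hυi : υ.var 7 = i := (hF'.1 7 (by simp [writtenVars, markNeighbor])).trans hτi
      rw [hτ.size] at hj
      rw [h.size] at hi
      have hrun := markNeighbor_run (a := a) (m := m) (u := ⟨i, hi⟩) (v := ⟨j, hj⟩) hυ hυi hυj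
      rw [hυa, ← hA] at hrun
      simp only [I, Memory.setVar_arr]
      rw [hrun]
      split_ifs with hc
      · refine ⟨hI1.trans (Finset.subset_insert _ _), fun u hu v huv hadj hv => ?_,
          fun C hC hC' => Finset.insert_subset (hC' _ (hI3 C hC hC' hc.1) _ hc.2.1 hc.2.2)
            (hI3 C hC hC')⟩
        by_cases hvj : v = ⟨j, hj⟩
        · simp [hvj]
        · have : (v : ℕ) ≠ j := fun e => hvj (Fin.ext e)
          exact Finset.mem_insert_of_mem (hI2 u hu v (by omega) hadj hv)
      · refine ⟨hI1, fun u hu v huv hadj hv => ?_, hI3⟩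
        by_cases huv' : (u : ℕ) = i ∧ (v : ℕ) = j
        · obtain rfl : u = ⟨i, hi⟩ := Fin.ext huv'.1
          obtain rfl : v = ⟨j, hj⟩ := Fin.ext huv'.2
          exact absurd ⟨hI1 hu, hadj, hv⟩ hc
        · exact hI2 u hu v (by omega) hadj hv
    obtain ⟨h1, h2, h3⟩ := hin
    refine ⟨h1, fun u hu v huv => h2 u hu v ?_, h3⟩
    rw [hτ.size]
    have := v.2
    omega
  obtain ⟨h1, h2, h3⟩ := hI
  exact ⟨h1, fun u hu v => h2 u hu v (.inl (by rw [h.size]; exact u.2)), h3⟩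

theorem clear_run (h : σ.var 0 = n) :
    ∀ i < n, ((loop 5 (.store m (.var 5) (.lit 0))).run σ).arr m i = 0 := by
  have := loop_invariant (x := 5) (P := .store m (.var 5) (.lit 0)) (σ := σ)
    (by simp [WellFormed, writtenVars]) (fun i τ => ∀ j < i, τ.arr m j = 0) (by simp)
    (fun i τ _ hi _ hI j hj => by
      simp only [run, Expr.eval, hi, Memory.setVar_arr, Memory.setArr_arr_self,
        Function.update_apply]
      split_ifs with hji
      · rfl
      · exact hI j (by omega))
  rwa [h] at this

/-- A vertex of the component is joined to s by a path with fewer than n edges, so n rounds of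
spreading reach it. -/
theorem mem_component_of_walk_induction {M : ℕ → Finset (Fin n)} (hs : s ∉ S) (h0 : s ∈ M 0)
    (hstep : ∀ i < n, ∀ u ∈ M i, ∀ v, G.Adj u v → v ∉ S → v ∈ M (i + 1))
    (hmono : ∀ i < n, M i ⊆ M (i + 1)) : component G S s ⊆ M n := by
  have hmono' : ∀ i ≤ n, ∀ j ≤ i, M j ⊆ M i := by
    intro i
    induction i with
    | zero =>
      intro _ j hj
      rw [Nat.le_zero.1 hj]
    | succ i ih =>
      intro hi j hj
      rcases Nat.le_succ_iff.1 hj with hj | rfl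
      · exact (ih (by omega) j hj).trans (hmono i hi)
      · exact subset_rfl
  -- Walks are directed towards s, so removing the first edge leaves the shorter walk that the
  -- induction needs.
  have key : ∀ (v : {v | v ∉ S}) (q : (G.induce {v | v ∉ S}).Walk v ⟨s, hs⟩), q.length ≤ n →
      v.1 ∈ M q.length := by
    intro v q
    generalize hw : (⟨s, hs⟩ : {v | v ∉ S}) = w at q
    induction q with
    | nil =>
      subst hw
      exact fun _ => h0
    | @cons a b c hab q ih =>
      intro hq
      rw [SimpleGraph.Walk.length_cons] at hq
      have hab' : G.Adj a.1 b.1 := by simpa using hab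
      exact hstep _ (by omega) b.1 (ih hw (by omega)) _ hab'.symm a.2
  intro v hv
  obtain ⟨_, hv', hr⟩ := mem_component.1 hv
  obtain ⟨q⟩ := hr.symm
  obtain ⟨p, hp⟩ := q.toPath
  have hlt := hp.length_lt
  have hle : p.length ≤ n := by
    have := Fintype.card_subtype_le (fun v : Fin n => v ∉ S)
    rw [Fintype.card_fin] at this
    refine hlt.le.trans (le_trans (le_of_eq ?_) this)
    exact Fintype.card_congr (Equiv.refl _)
  exact hmono' n le_rfl _ hle (key _ p hle)

theorem markComponent_run (h : Holds G s t σ) (ham : a ≠ m) (h0 : m ≠ 0) (h4 : m ≠ 4)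
    (hs : s ∉ indicatedSet n (σ.arr a)) :
    indicatedSet n (((markComponent a m).run σ).arr m) =
      component G (indicatedSet n (σ.arr a)) s := by
  set S := indicatedSet n (σ.arr a) with hS
  set σ₁ := (loop 5 (.store m (.var 5) (.lit 0))).run σ with hσ₁
  set σ₂ := (ForProgram.store m (.var 1) (.lit 1)).run σ₁ with hσ₂
  have hF₁ : Frame _ σ σ₁ := frame_run _ _
  have hH₁ : Holds G s t σ₁ := h.frame hF₁ (by simp [writtenVars])
    (by simp [writtenArrs, h0.symm, h4.symm])
  have hF₂ : Frame _ σ₁ σ₂ := frame_run _ _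
  have hH₂ : Holds G s t σ₂ := hH₁.frame hF₂ (by simp [writtenVars])
    (by simp [writtenArrs, h0.symm, h4.symm])
  have ha₂ : σ₂.arr a = σ.arr a := (hF₂.2 a (by simp [writtenArrs, ham])).trans
    (hF₁.2 a (by simp [writtenArrs, ham]))
  have hM₂ : indicatedSet n (σ₂.arr m) = {s} := by
    have hc := clear_run (m := m) h.size
    rw [hσ₂, run, Memory.setArr_arr_self, Expr.eval, Expr.eval, hH₁.source, indicatedSet_update_one]
    ext w
    simp [mem_indicatedSet, hσ₁, hc w w.2]
  have hinv := loop_invariant (x := 6) (P := markNeighbors a m) (σ := σ₂)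
    (by simp [WellFormed, writtenVars, markNeighbors, markNeighbor])
    -- The sequence `M` records the marks after each round; it exists only in the proof and carries
    -- the lower bound on what is marked.
    (fun i τ => indicatedSet n (τ.arr m) ⊆ component G S s ∧
      ∃ M : ℕ → Finset (Fin n), s ∈ M 0 ∧ M i ⊆ indicatedSet n (τ.arr m) ∧
        (∀ j < i, ∀ u ∈ M j, ∀ v, G.Adj u v → v ∉ S → v ∈ M (j + 1)) ∧ ∀ j < i, M j ⊆ M (j + 1))
    ⟨by simpa [hM₂] using self_mem_component hs, fun _ => {s}, by simp, by simp [hM₂], by simp,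
      by simp⟩ (by
      rintro i τ - hi hF ⟨hI, M, hM0, hMi, hM1, hM2⟩
      have hτ : Holds G s t τ := hH₂.frame hF (by simp [writtenVars, writtenVars_markNeighbors])
        (by simp [writtenArrs, writtenArrs_markNeighbors, h0.symm, h4.symm])
      have hτa : τ.arr a = σ.arr a :=
        (hF.2 a (by simp [writtenArrs, writtenArrs_markNeighbors, ham])).trans ha₂
      obtain ⟨h1, h2, h3⟩ := markNeighbors_run hτ ham h0 h4
      rw [hτa, ← hS] at h2 h3
      simp only [Memory.setVar_arr]
      refine ⟨h3 _ hI fun u hu v huv hv => mem_component_of_adj hu huv hv,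
        fun j => if j ≤ i then M j else indicatedSet n (((markNeighbors a m).run τ).arr m),
        by simpa using hM0, by simp, fun j hj u hu v huv hv => ?_, fun j hj => ?_⟩
      · have hji : j ≤ i := by omega
        simp only [hji, if_true] at hu
        by_cases hj' : j + 1 ≤ i
        · simpa [hj'] using hM1 j (by omega) u hu v huv hv
        · obtain rfl : j = i := by omega
          simpa using h2 u (hMi hu) v huv hv
      · have hji : j ≤ i := by omega
        by_cases hj' : j + 1 ≤ i
        · simpa [hj', hji] using hM2 j (by omega)
        · obtain rfl : j = i := by omega
          simpa using hMi.trans h1)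
  rw [hH₂.size] at hinv
  obtain ⟨hI, M, hM0, hMi, hM1, hM2⟩ := hinv
  exact subset_antisymm hI ((mem_component_of_walk_induction hs hM0 hM1 hM2).trans hMi)

/-! ### Testing and finding a slide -/

theorem copySet_run (h : σ.var 0 = n) :
    indicatedSet n ((copySet.run σ).arr 7) = indicatedSet n (σ.arr 1) := by
  refine indicatedSet_congr ?_
  have := loop_invariant (x := 5) (P := .store 7 (.var 5) (.get 1 (.var 5))) (σ := σ)
    (by simp [WellFormed, writtenVars]) (fun i τ => ∀ j < i, τ.arr 7 j = σ.arr 1 j) (by simp)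
    (fun i τ _ hi hF hI j hj => by
      have h1 : τ.arr 1 = σ.arr 1 := hF.2 1 (by simp [writtenArrs])
      simp only [run, Expr.eval, hi, Memory.setVar_arr, Memory.setArr_arr_self,
        Function.update_apply, h1]
      split_ifs with hji
      · rw [hji]
      · exact hI j (by omega))
  rwa [h] at this

theorem testSlide_run (h : Holds G s t σ) (hv : σ.var 9 = v) (hu : σ.var 10 = u)
    (hS : indicatedSet n (σ.arr 1) = S) (hsS : s ∉ S) (htS : t ∉ S) (hus : u ≠ s) (hut : u ≠ t) :
    (IsSeparator G s t (insert u (S.erase v)) → (testSlide.run σ).var 12 = 1 ∧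
      (testSlide.run σ).var 13 = v ∧ (testSlide.run σ).var 14 = u) ∧
    (¬ IsSeparator G s t (insert u (S.erase v)) → (testSlide.run σ).var 12 = σ.var 12 ∧
      (testSlide.run σ).var 13 = σ.var 13 ∧ (testSlide.run σ).var 14 = σ.var 14) := by
  rw [testSlide, run_seq, run_seq]
  set P₁ : ForProgram :=
    .seq copySet (.seq (.store 7 (.var 9) (.lit 0)) (.store 7 (.var 10) (.lit 1))) with hP₁
  have hF₁ := frame_run P₁ σ
  have h7 : indicatedSet n ((P₁.run σ).arr 7) = insert u (S.erase v) := by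
    have hc : ∀ x, x ≠ 5 → (copySet.run σ).var x = σ.var x :=
      fun x hx => run_var_eq (by simp [copySet, writtenVars, hx])
    simp [hP₁, run, Expr.eval, hc, hv, hu, indicatedSet_update_one, indicatedSet_update_zero,
      copySet_run h.size, hS]
  set σ₁ := P₁.run σ
  have hH₁ : Holds G s t σ₁ := h.frame hF₁ (by simp [hP₁, copySet, writtenVars])
    (by simp [hP₁, copySet, writtenArrs])
  have hs' : s ∉ insert u (S.erase v) := by simp [hsS, hus.symm]
  have ht' : t ∉ insert u (S.erase v) := by simp [htS, hut.symm]
  have h8 := markComponent_run (a := 7) (m := 8) hH₁ (by simp) (by simp) (by simp) (by rwa [h7])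
  rw [h7] at h8
  have hF₂ := frame_run (markComponent 7 8) σ₁
  set σ₂ := (markComponent 7 8).run σ₁
  have hvar : ∀ x, x = 9 ∨ x = 10 ∨ x = 12 ∨ x = 13 ∨ x = 14 → σ₂.var x = σ.var x := by
    intro x hx
    rw [hF₂.1 x, hF₁.1 x]
    · rcases hx with rfl | rfl | rfl | rfl | rfl <;> simp [hP₁, copySet, writtenVars]
    · rcases hx with rfl | rfl | rfl | rfl | rfl <;>
        simp [markComponent, markNeighbors, markNeighbor, writtenVars]
  have hH₂ : Holds G s t σ₂ := hH₁.frame hF₂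
    (by simp [markComponent, markNeighbors, markNeighbor, writtenVars])
    (by simp [markComponent, markNeighbors, markNeighbor, writtenArrs])
  have hsep : IsSeparator G s t (insert u (S.erase v)) ↔ σ₂.arr 8 t = 0 := by
    rw [isSeparator_iff, ← h8, mem_indicatedSet]
    simp only [hs', ht', not_false_eq_true, true_and, not_not]
  rw [run_whenAll]
  simp only [List.forall_mem_cons, List.not_mem_nil, false_imp_iff, implies_true, and_true,
    eval_negExpr, Expr.eval, hH₂.target, hsep]
  constructor
  · intro h0
    simp [h0, run, Memory.setVar_var, Expr.eval, hvar, hv, hu]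
  · intro h0
    simp [h0, hvar]

/-- The memory holds the instance, the current set `S` and the side of `s` in `G - B`. -/
structure Loaded (G : SimpleGraph (Fin n)) (s t : Fin n) (B S : Finset (Fin n)) (σ : Memory) :
    Prop extends Holds G s t σ where
  current : indicatedSet n (σ.arr 1) = S
  goal : indicatedSet n (σ.arr 2) = B
  goalSide : indicatedSet n (σ.arr 5) = component G B s

theorem Loaded.frame {P : ForProgram} (h : Loaded G s t B S σ) (hF : P.Frame σ τ)
    (hv : 0 ∉ P.writtenVars ∧ 1 ∉ P.writtenVars ∧ 2 ∉ P.writtenVars)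
    (ha : 0 ∉ P.writtenArrs ∧ 1 ∉ P.writtenArrs ∧ 2 ∉ P.writtenArrs ∧ 4 ∉ P.writtenArrs ∧
      5 ∉ P.writtenArrs) : Loaded G s t B S τ :=
  ⟨h.toHolds.frame hF hv ⟨ha.1, ha.2.2.2.1⟩, by rw [hF.2 _ ha.2.1, h.current],
    by rw [hF.2 _ ha.2.2.1, h.goal], by rw [hF.2 _ ha.2.2.2.2, h.goalSide]⟩

theorem Loaded.setVar (h : Loaded G s t B S σ) {x i : ℕ} (hx : 2 < x) :
    Loaded G s t B S (σ.setVar x i) :=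
  ⟨h.toHolds.of_eq (by rw [Memory.setVar_var, if_neg (by omega)])
    (by rw [Memory.setVar_var, if_neg (by omega)]) (by rw [Memory.setVar_var, if_neg (by omega)])
    rfl rfl, h.current, h.goal, h.goalSide⟩

/-- Sliding a token from `v` to `u` moves it towards `B` and results in a separator. -/
def IsGoodSlide (G : SimpleGraph (Fin n)) (s t : Fin n) (B S : Finset (Fin n)) (v u : Fin n) :
    Prop :=
  IsTowards G s S B v u ∧ IsSeparator G s t (insert u (S.erase v))

/-- The program excludes u = s and u = t beforehand because the marking test presupposes that both
terminals survive: t stays unmarked also when it is deleted. No good slide is lost, as a separator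
contains neither terminal. -/
theorem trySlide_run (h : Loaded G s t B S σ) (hv : σ.var 9 = v) (hu : σ.var 10 = u)
    (hS : IsSeparator G s t S) (h6 : indicatedSet n (σ.arr 6) = component G S s) :
    (IsGoodSlide G s t B S v u → (trySlide.run σ).var 12 = 1 ∧
      (trySlide.run σ).var 13 = v ∧ (trySlide.run σ).var 14 = u) ∧
    (¬ IsGoodSlide G s t B S v u → (trySlide.run σ).var 12 = σ.var 12 ∧
      (trySlide.run σ).var 13 = σ.var 13 ∧ (trySlide.run σ).var 14 = σ.var 14) := by
  obtain ⟨hsS, htS, -⟩ := isSeparator_iff.1 hS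
  have hcond : (∀ e ∈ [.get 1 (.var 9), negExpr (.get 1 (.var 10)), adjExpr 9 10,
      negExpr (.get 2 (.var 9)),
      .eq (.lt (.lit 0) (.get 5 (.var 9))) (negExpr (.get 6 (.var 10))),
      negExpr (.eq (.var 10) (.var 1)), negExpr (.eq (.var 10) (.var 2))], e.eval σ ≠ 0) ↔
      IsTowards G s S B v u ∧ u ≠ s ∧ u ≠ t := by
    simp only [List.forall_mem_cons, List.not_mem_nil, false_imp_iff, implies_true, and_true,
      eval_negExpr, h.toHolds.eval_adjExpr hv hu, IsTowards, ← h.goalSide, ← h6, mem_indicatedSet]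
    rw [← h.current, ← h.goal, mem_indicatedSet, mem_indicatedSet, mem_indicatedSet]
    simp only [negExpr, Expr.eval, hv, hu, h.source, h.target, Fin.val_inj, ← Nat.pos_iff_ne_zero]
    split_ifs <;> simp_all
  rw [trySlide, run_whenAll]
  by_cases hc : IsTowards G s S B v u ∧ u ≠ s ∧ u ≠ t
  · rw [if_pos (hcond.2 hc)]
    simpa [IsGoodSlide, hc.1] using
      testSlide_run h.toHolds hv hu h.current hsS htS hc.2.1 hc.2.2
  · rw [if_neg (hcond.not.2 hc)]
    refine ⟨fun hg => absurd ⟨hg.1, ?_, ?_⟩ hc, fun _ => ⟨rfl, rfl, rfl⟩⟩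
    · rintro rfl
      exact (isSeparator_iff.1 hg.2).1 (Finset.mem_insert_self _ _)
    · rintro rfl
      exact (isSeparator_iff.1 hg.2).2.1 (Finset.mem_insert_self _ _)

theorem searchSlide_run (h : Loaded G s t B S σ) (hS : IsSeparator G s t S)
    (h6 : indicatedSet n (σ.arr 6) = component G S s) :
    ((searchSlide.run σ).var 12 ≠ 0 → ∃ v u : Fin n, (searchSlide.run σ).var 13 = v ∧
      (searchSlide.run σ).var 14 = u ∧ IsGoodSlide G s t B S v u) ∧
    ((searchSlide.run σ).var 12 = 0 → ∀ v u, ¬ IsGoodSlide G s t B S v u) := by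
  rw [searchSlide, run_seq]
  set σ₁ := (ForProgram.assign 12 (.lit 0)).run σ with hσ₁
  have h₁ : Loaded G s t B S σ₁ := h.setVar (by simp)
  have h6₁ : indicatedSet n (σ₁.arr 6) = component G S s := h6
  have h12 : σ₁.var 12 = 0 := by simp [hσ₁, run, Expr.eval]
  clear_value σ₁
  -- A raised flag certifies the stored pair; a flag still zero means that no pair lexicographically
  -- before (i, j) is good.
  let I : ℕ → ℕ → Memory → Prop := fun i j τ =>
    (τ.var 12 ≠ 0 → ∃ v u : Fin n, τ.var 13 = v ∧ τ.var 14 = u ∧ IsGoodSlide G s t B S v u) ∧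
    (τ.var 12 = 0 → ∀ v u : Fin n, v < i ∨ (v = i ∧ u < j) → ¬ IsGoodSlide G s t B S v u)
  have hI : I (σ₁.var 0) 0 ((loop 9 (loop 10 trySlide)).run σ₁) := by
    refine loop_invariant (x := 9) ?_ (fun i => I i 0) ?_ ?_
    · simp [WellFormed, writtenVars, trySlide, testSlide, copySet, markComponent, markNeighbors,
        markNeighbor]
    · simp [I, h12, Memory.setVar_var]
    intro i τ hi hτi hF hIτ
    have hτ : Loaded G s t B S τ := h₁.frame hF
      (by simp [writtenVars, trySlide, testSlide, copySet, markComponent, markNeighbors,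
        markNeighbor])
      (by simp [writtenArrs, trySlide, testSlide, copySet, markComponent, markNeighbors,
        markNeighbor])
    have hτ6 : indicatedSet n (τ.arr 6) = component G S s := by
      rw [hF.2 6 (by simp [writtenArrs, trySlide, testSlide, copySet, markComponent,
        markNeighbors, markNeighbor]), h6₁]
    have hin : I i (τ.var 0) ((loop 10 trySlide).run τ) := by
      refine loop_invariant (x := 10) ?_ (fun j => I i j) ?_ ?_
      · simp [WellFormed, writtenVars, trySlide, testSlide, copySet, markComponent, markNeighbors,
          markNeighbor]
      · simpa [I, Memory.setVar_var] using hIτ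
      rintro j υ hj hυj hF' ⟨hI1, hI2⟩
      have hυ : Loaded G s t B S υ := hτ.frame hF'
        (by simp [writtenVars, trySlide, testSlide, copySet, markComponent, markNeighbors,
          markNeighbor])
        (by simp [writtenArrs, trySlide, testSlide, copySet, markComponent, markNeighbors,
          markNeighbor])
      have hυ6 : indicatedSet n (υ.arr 6) = component G S s := by
        rw [hF'.2 6 (by simp [writtenArrs, trySlide, testSlide, copySet, markComponent,
          markNeighbors, markNeighbor]), hτ6]
      have hυi : υ.var 9 = i := (hF'.1 9 (by simp [writtenVars, trySlide, testSlide, copySet,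
        markComponent, markNeighbors, markNeighbor])).trans hτi
      rw [hτ.size] at hj
      rw [h₁.size] at hi
      obtain ⟨hr1, hr2⟩ := trySlide_run (v := ⟨i, hi⟩) (u := ⟨j, hj⟩) hυ hυi hυj hS hυ6
      simp only [I, Memory.setVar_var]
      norm_num
      by_cases hg : IsGoodSlide G s t B S ⟨i, hi⟩ ⟨j, hj⟩
      · obtain ⟨e1, e2, e3⟩ := hr1 hg
        rw [e1, e2, e3]
        exact ⟨fun _ => ⟨_, rfl, _, rfl, hg⟩, by simp⟩
      · obtain ⟨e1, e2, e3⟩ := hr2 hg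
        rw [e1, e2, e3]
        refine ⟨by simpa using hI1, fun h0 v u hvu => ?_⟩
        by_cases huv' : (v : ℕ) = i ∧ (u : ℕ) = j
        · obtain rfl : v = ⟨i, hi⟩ := Fin.ext huv'.1
          obtain rfl : u = ⟨j, hj⟩ := Fin.ext huv'.2
          exact hg
        · exact hI2 h0 v u (by omega)
    obtain ⟨h1, h2⟩ := hin
    simp only [I, Memory.setVar_var]
    norm_num
    refine ⟨by simpa using h1, fun h0 v u hv => h2 h0 v u ?_⟩
    rw [hτ.size]
    have := u.2
    omega
  obtain ⟨h1, h2⟩ := hI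
  exact ⟨h1, fun h0 v u => h2 h0 v u (.inl (by rw [h₁.size]; exact v.2))⟩

/-! ### Writing the output and performing a slide -/

theorem outputSequence_eq (n : ℕ) (σ : Memory) : outputSequence n σ =
    (List.range (σ.var 4)).map fun i => Finset.univ.filter fun v : Fin n =>
      σ.arr 3 (i * n + v) = 1 := by
  refine List.ext_getElem (by simp [outputSequence]) fun i h1 h2 => ?_
  simp [outputSequence]

theorem outputSequence_congr (h4 : τ.var 4 = σ.var 4) (h3 : τ.arr 3 = σ.arr 3) :
    outputSequence n τ = outputSequence n σ := by
  rw [outputSequence_eq, outputSequence_eq, h3, h4]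

theorem length_outputSequence : (outputSequence n σ).length = σ.var 4 := by
  simp [outputSequence]

theorem appendOutput_run (h : Holds G s t σ) (hc : σ.var 4 ≤ n) :
    outputSequence n (appendOutput.run σ) = outputSequence n σ ++ [indicatedSet n (σ.arr 1)] ∧
      (appendOutput.run σ).var 4 = σ.var 4 + 1 := by
  have hv4 : (appendOutput.run σ).var 4 = σ.var 4 + 1 := by
    rw [appendOutput, run_seq]
    simp only [run.eq_2, Expr.eval, Memory.setVar_var_self]
    rw [run_var_eq (by simp [writtenVars])]
  have hinv := loop_invariant (x := 5)
    (P := .store 3 (.add (.get 4 (.var 4)) (.var 5)) (.lt (.lit 0) (.get 1 (.var 5)))) (σ := σ)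
    (by simp [WellFormed, writtenVars])
    -- The second clause protects the sets already written, all of which lie below the address of
    -- the new block.
    (fun i τ => (∀ j < i, (τ.arr 3 (σ.var 4 * n + j) = 1 ↔ σ.arr 1 j ≠ 0)) ∧
      ∀ k < σ.var 4 * n, τ.arr 3 k = σ.arr 3 k) (by simp)
    (fun i τ _ hi hF hI => by
      have h1 : τ.arr 1 = σ.arr 1 := hF.2 1 (by simp [writtenArrs])
      have h2 : τ.arr 4 = σ.arr 4 := hF.2 4 (by simp [writtenArrs])
      have h3 : τ.var 4 = σ.var 4 := hF.1 4 (by simp [writtenVars])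
      simp only [run, Expr.eval, hi, Memory.setVar_arr, Memory.setArr_arr_self,
        Function.update_apply, h1, h2, h3, h.rows _ hc]
      refine ⟨fun j hj => ?_, fun k hk => ?_⟩
      · by_cases hji : j = i
        · simp [hji, Nat.pos_iff_ne_zero]
        · rw [if_neg (by omega)]
          exact hI.1 j (by omega)
      · rw [if_neg (by omega)]
        exact hI.2 k hk)
  rw [h.size] at hinv
  have h3 : (appendOutput.run σ).arr 3 = ((loop 5 (.store 3 (.add (.get 4 (.var 4)) (.var 5))
    (.lt (.lit 0) (.get 1 (.var 5))))).run σ).arr 3 := rfl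
  rw [← h3] at hinv
  refine ⟨?_, hv4⟩
  rw [outputSequence_eq, outputSequence_eq, hv4, List.range_succ, List.map_append]
  congr 1
  · refine List.map_congr_left fun i hi => Finset.filter_congr fun v _ => ?_
    rw [hinv.2]
    have h1 : i + 1 ≤ σ.var 4 := List.mem_range.1 hi
    have h2 := Nat.mul_le_mul_right n h1
    have := v.2
    rw [Nat.succ_mul] at h2
    omega
  · rw [List.map_singleton]
    congr 1
    ext v
    rw [mem_indicatedSet, Finset.mem_filter, hinv.1 v v.2]
    simp

theorem slideOnce_run (h : Loaded G s t B S σ) (hS : IsSeparator G s t S) (hc : σ.var 4 ≤ n) :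
    ((∀ v u, ¬ IsGoodSlide G s t B S v u) ∧ Loaded G s t B S (slideOnce.run σ) ∧
      outputSequence n (slideOnce.run σ) = outputSequence n σ) ∨
    ∃ v u, IsGoodSlide G s t B S v u ∧
      Loaded G s t B (insert u (S.erase v)) (slideOnce.run σ) ∧
      outputSequence n (slideOnce.run σ) = outputSequence n σ ++ [insert u (S.erase v)] := by
  rw [slideOnce, run_seq, run_seq]
  have hF₁ := frame_run (markComponent 1 6) σ
  have h6 := markComponent_run (a := 1) (m := 6) h.toHolds (by simp) (by simp) (by simp)
    (by rw [h.current]; exact (isSeparator_iff.1 hS).1)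
  rw [h.current] at h6
  set σ₁ := (markComponent 1 6).run σ
  have h₁ : Loaded G s t B S σ₁ := h.frame hF₁
    (by simp [markComponent, markNeighbors, markNeighbor, writtenVars])
    (by simp [markComponent, markNeighbors, markNeighbor, writtenArrs])
  have hr := searchSlide_run h₁ hS h6
  have hF₂ := frame_run searchSlide σ₁
  set σ₂ := searchSlide.run σ₁
  have h₂ : Loaded G s t B S σ₂ := h₁.frame hF₂
    (by simp [searchSlide, writtenVars, trySlide, testSlide, copySet, markComponent,
      markNeighbors, markNeighbor])
    (by simp [searchSlide, writtenArrs, trySlide, testSlide, copySet, markComponent,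
      markNeighbors, markNeighbor])
  have h4 : σ₂.var 4 = σ.var 4 := by
    rw [hF₂.1, hF₁.1]
    · simp [markComponent, markNeighbors, markNeighbor, writtenVars]
    · simp [searchSlide, writtenVars, trySlide, testSlide, copySet, markComponent,
        markNeighbors, markNeighbor]
  have h3 : σ₂.arr 3 = σ.arr 3 := by
    rw [hF₂.2, hF₁.2]
    · simp [markComponent, markNeighbors, markNeighbor, writtenArrs]
    · simp [searchSlide, writtenArrs, trySlide, testSlide, copySet, markComponent,
        markNeighbors, markNeighbor]
  have hout : outputSequence n σ₂ = outputSequence n σ := outputSequence_congr h4 h3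
  clear_value σ₂
  rw [run_whenAll]
  simp only [List.forall_mem_cons, List.not_mem_nil, false_imp_iff, implies_true, and_true,
    Expr.eval]
  by_cases h12 : σ₂.var 12 = 0
  · left
    rw [if_neg (by simpa using h12)]
    exact ⟨hr.2 h12, h₂, hout⟩
  · right
    rw [if_pos h12]
    obtain ⟨v, u, hv, hu, hg⟩ := hr.1 h12
    refine ⟨v, u, hg, ?_⟩
    rw [run_seq]
    set P₃ : ForProgram := .seq (.store 1 (.var 13) (.lit 0)) (.store 1 (.var 14) (.lit 1))
      with hP₃
    have hF₃ := frame_run P₃ σ₂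
    have hcur : indicatedSet n ((P₃.run σ₂).arr 1) = insert u (S.erase v) := by
      simp [hP₃, run, Expr.eval, hv, hu, indicatedSet_update_one, indicatedSet_update_zero,
        h₂.current]
    set σ₃ := P₃.run σ₂
    have h₃ : Loaded G s t B (insert u (S.erase v)) σ₃ :=
      ⟨h₂.toHolds.frame hF₃ (by simp [hP₃, writtenVars]) (by simp [hP₃, writtenArrs]), hcur,
        by rw [hF₃.2 2 (by simp [hP₃, writtenArrs]), h₂.goal],
        by rw [hF₃.2 5 (by simp [hP₃, writtenArrs]), h₂.goalSide]⟩
    have h4₃ : σ₃.var 4 = σ.var 4 := by rw [hF₃.1 4 (by simp [hP₃, writtenVars]), h4]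
    have hout₃ : outputSequence n σ₃ = outputSequence n σ :=
      outputSequence_congr h4₃ ((hF₃.2 3 (by simp [hP₃, writtenArrs])).trans h3)
    refine ⟨h₃.frame (frame_run _ _) (by simp [appendOutput, writtenVars])
      (by simp [appendOutput, writtenArrs]), ?_⟩
    rw [(appendOutput_run h₃.toHolds (by rw [h4₃]; exact hc)).1, hcur, hout₃]

/-! ### Initialisation, the final test and the greedy loop -/

theorem buildRows_run (h0 : σ.var 0 = n) (h6 : σ.var 6 = 0) :
    ∀ i ≤ n, (buildRows.run σ).arr 4 i = i * n := by
  have hinv := loop_invariant (x := 5) (σ := σ)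
    (P := .seq (.store 4 (.var 5) (.var 6)) (.assign 6 (.add (.var 6) (.var 0))))
    (by simp [WellFormed, writtenVars])
    (fun i τ => τ.var 6 = i * n ∧ ∀ j < i, τ.arr 4 j = j * n) (by simp [Memory.setVar_var, h6])
    (fun i τ _ hi hF hI => by
      have h0' : τ.var 0 = n := (hF.1 0 (by simp [writtenVars])).trans h0
      refine ⟨by simp [run, Expr.eval, Memory.setVar_var, hI.1, h0', Nat.succ_mul],
        fun j hj => ?_⟩
      simp only [run, Expr.eval, hi, Memory.setVar_arr, Memory.setArr_arr_self,
        Function.update_apply]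
      split_ifs with hji
      · rw [hji, hI.1]
      · exact hI.2 j (by omega))
  have hv0 : ((loop 5 (.seq (.store 4 (.var 5) (.var 6))
      (.assign 6 (.add (.var 6) (.var 0))))).run σ).var 0 = n :=
    (run_var_eq (by simp [writtenVars])).trans h0
  intro i hi
  rw [buildRows, run_seq]
  generalize (loop 5 (.seq (.store 4 (.var 5) (.var 6))
      (.assign 6 (.add (.var 6) (.var 0))))).run σ = τ at *
  simp only [run, Expr.eval, Memory.setArr_arr_self, Function.update_apply, hv0]
  rw [h0] at hinv
  split_ifs with hin
  · rw [hin, hinv.1]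
  · exact hinv.2 i (by omega)

open Classical in
theorem decideDone_run (h0 : σ.var 0 = n) : (decideDone.run σ).var 3 =
    if indicatedSet n (σ.arr 1) ⊆ indicatedSet n (σ.arr 2) then 1 else 0 := by
  rw [decideDone, run_seq]
  set σ₁ := (ForProgram.assign 3 (.lit 1)).run σ with hσ₁
  have h3 : σ₁.var 3 = 1 := by simp [hσ₁, run, Expr.eval]
  have h0' : σ₁.var 0 = n := by simp [hσ₁, run, Expr.eval, Memory.setVar_var, h0]
  have ha : σ₁.arr = σ.arr := rfl
  rw [← ha]
  clear_value σ₁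
  have hinv := loop_invariant (x := 5) (σ := σ₁)
    (P := whenAll [.get 1 (.var 5), negExpr (.get 2 (.var 5))] (.assign 3 (.lit 0)))
    (by simp [WellFormed, writtenVars])
    (fun i τ => τ.var 3 = if ∀ j < i, σ₁.arr 1 j ≠ 0 → σ₁.arr 2 j ≠ 0 then 1 else 0)
    (by simp [Memory.setVar_var, h3])
    (fun i τ _ hi hF hI => by
      have h1 : τ.arr 1 = σ₁.arr 1 := hF.2 1 (by simp [writtenArrs])
      have h2 : τ.arr 2 = σ₁.arr 2 := hF.2 2 (by simp [writtenArrs])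
      rw [Memory.setVar_var, if_neg (by simp), run_whenAll]
      simp only [List.forall_mem_cons, List.not_mem_nil, false_imp_iff, implies_true, and_true,
        eval_negExpr]
      simp only [Expr.eval, hi, h1, h2, Nat.forall_lt_succ_right]
      by_cases hc : σ₁.arr 1 i ≠ 0 ∧ σ₁.arr 2 i = 0
      · rw [if_pos hc, if_neg (by tauto)]
        simp [run, Expr.eval]
      · rw [if_neg hc, hI]
        congr 1
        simp only [eq_iff_iff]
        tauto)
  rw [hinv, h0']
  congr 1
  simp only [eq_iff_iff]
  constructor
  · intro h v hv
    rw [mem_indicatedSet] at hv ⊢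
    exact h v v.2 hv
  · intro h j hj hj1
    have := @h ⟨j, hj⟩
    simp only [mem_indicatedSet] at this
    exact this hj1

/-- The sum of output length and remaining distance is invariant, since every slide performed moves
towards B. At S = B it gives the optimal length. -/
theorem slidingLoop_run (h : Loaded G s t B A σ) (hA : IsMinSeparator G s t A)
    (hB : IsMinSeparator G s t B) (hout : outputSequence n σ = [A]) :
    ∃ S, Loaded G s t B S ((loop 11 slideOnce).run σ) ∧ IsMinSeparator G s t S ∧
      IsSlideSequence G s t A S (outputSequence n ((loop 11 slideOnce).run σ)) ∧
      (outputSequence n ((loop 11 slideOnce).run σ)).length + slideDist G s t S B =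
        slideDist G s t A B + 1 ∧
      ((∃ L, IsSlideSequence G s t A B L) → S = B) := by
  have hwf : (loop 11 slideOnce).WellFormed :=
    slidingProgram_wellFormed.2.2.2.1
  have hstep : ∀ {S : Finset (Fin n)} {v u : Fin n}, IsMinSeparator G s t S →
      IsGoodSlide G s t B S v u → MinSlide G s t v u S (insert u (S.erase v)) := by
    rintro S v u hS ⟨⟨hv, hu, hvu, -⟩, hsep⟩
    exact ⟨hS, hS.of_card_eq hsep (card_insert_erase hv hu), hv, hu, hvu, rfl⟩
  have hinv := loop_invariant (x := 11) (σ := σ) hwf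
    (fun i τ => ∃ S, Loaded G s t B S τ ∧ IsMinSeparator G s t S ∧
      IsSlideSequence G s t A S (outputSequence n τ) ∧
      (outputSequence n τ).length + slideDist G s t S B = slideDist G s t A B + 1 ∧
      ((∃ L, IsSlideSequence G s t A B L) → ∃ L, IsSlideSequence G s t S B L) ∧
      -- Either every round so far has made a slide, or the search is stuck for good.
      ((outputSequence n τ).length = i + 1 ∨
        (outputSequence n τ).length ≤ i ∧ ∀ v u, ¬ IsGoodSlide G s t B S v u)) (by
      have he : outputSequence n (σ.setVar 11 0) = [A] := by
        rw [← hout]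
        exact outputSequence_congr (by simp [Memory.setVar_var]) rfl
      refine ⟨A, h.setVar (by simp), hA, ?_⟩
      rw [he]
      exact ⟨isSlideSequence_singleton hA, by simp [add_comm], id, by simp⟩)
    (by
      rintro i τ hi - - ⟨S, hL, hS, hseq, hlen, hreach, hcnt⟩
      have he : ∀ υ : Memory, outputSequence n (υ.setVar 11 (i + 1)) = outputSequence n υ :=
        fun υ => outputSequence_congr (by simp [Memory.setVar_var]) rfl
      rw [h.size] at hi
      have hc : τ.var 4 ≤ n := by
        rw [← length_outputSequence (n := n)]
        omega
      simp only [he]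
      rcases slideOnce_run hL hS.1 hc with ⟨hno, hL', ho⟩ | ⟨v, u, hg, hL', ho⟩
      · refine ⟨S, hL'.setVar (by simp), hS, ?_⟩
        rw [ho]
        exact ⟨hseq, hlen, hreach, .inr ⟨by omega, hno⟩⟩
      · have hm := hstep hS hg
        have hsl : IsSlide G S (insert u (S.erase v)) := ⟨v, hm.mem, u, hm.notMem, hm.adj, rfl⟩
        refine ⟨insert u (S.erase v), hL'.setVar (by simp), hm.right, ?_⟩
        rw [ho]
        refine ⟨hseq.concat hsl hm.right, ?_, fun hex => ?_, ?_⟩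
        · have := hm.slideDist_eq hg.1
          simp only [List.length_append, List.length_singleton]
          omega
        · obtain ⟨L, hL⟩ := hreach hex
          exact ⟨_, hL.cons hsl.symm hm.right⟩
        · rcases hcnt with hcnt | hcnt
          · exact .inl (by simp [hcnt])
          · exact absurd hg (hcnt.2 v u))
  rw [h.size] at hinv
  obtain ⟨S, hL, hS, hseq, hlen, hreach, hcnt⟩ := hinv
  refine ⟨S, hL, hS, hseq, hlen, fun hex => ?_⟩
  by_contra hne
  obtain ⟨v, u, hg⟩ := exists_isTowards hS hB (hreach hex) hne
  rcases hcnt with hcnt | hcnt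
  -- After n slides the distance, initially at most n, is zero, so no further slide can lower it.
  · have h1 := slideDist_le_card (G := G) (s := s) (t := t) (S := A) (B := B)
    have h2 := (hstep hS hg).slideDist_eq hg.1
    rw [Fintype.card_fin] at h1
    omega
  · exact hcnt.2 v u hg

theorem indicatedSet_inputMemory (k : ℕ) (hk : k = 1 ∨ k = 2) :
    indicatedSet n ((inputMemory G s t A B).arr k) = if k = 1 then A else B := by
  ext w
  rw [mem_indicatedSet]
  rcases hk with rfl | rfl <;> simp [inputMemory, Fin.val_inj]

/-- An address determines its row and column, because the column is its remainder modulo n. -/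
theorem inputMemory_adj : (inputMemory G s t A B).arr 0 (u * n + v) ≠ 0 ↔ G.Adj u v := by
  simp only [inputMemory, if_true, ite_ne_right_iff]
  constructor
  · rintro ⟨⟨u', v', he, hadj⟩, -⟩
    have hd := congrArg (· / n) he
    have hm := congrArg (· % n) he
    have hn : 0 < n := u.pos
    simp only [Nat.mul_add_mod', Nat.mod_eq_of_lt v.2, Nat.mod_eq_of_lt v'.2] at hm
    rw [hm, Nat.add_right_cancel_iff] at he
    rwa [Fin.ext (Nat.eq_of_mul_eq_mul_right hn he), Fin.ext hm]
  · exact fun h => ⟨⟨u, v, rfl, h⟩, one_ne_zero⟩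

theorem slidingProgram_run (hA : IsMinSeparator G s t A) (hB : IsMinSeparator G s t B) :
    ((∃ L, IsSlideSequence G s t A B L) →
      OutputYes (slidingProgram.run (inputMemory G s t A B)) ∧
      IsShortestSlideSequence G s t A B
        (outputSequence n (slidingProgram.run (inputMemory G s t A B)))) ∧
    ((¬ ∃ L, IsSlideSequence G s t A B L) →
      OutputNo (slidingProgram.run (inputMemory G s t A B))) := by
  rw [slidingProgram, run_seq, run_seq, run_seq, run_seq]
  set σ := inputMemory G s t A B with hσ
  have hF₁ := frame_run buildRows σ
  have hrows := buildRows_run (σ := σ) (n := n) (by simp [hσ, inputMemory])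
    (by simp [hσ, inputMemory])
  set σ₁ := buildRows.run σ
  have hv₁ : ∀ x, x ≠ 5 → x ≠ 6 → σ₁.var x = σ.var x := fun x h5 h6 =>
    hF₁.1 x (by simp [buildRows, writtenVars, h5, h6])
  have ha₁ : ∀ a, a ≠ 4 → σ₁.arr a = σ.arr a := fun a h4 =>
    hF₁.2 a (by simp [buildRows, writtenArrs, h4])
  have hH₁ : Holds G s t σ₁ := by
    refine ⟨?_, ?_, ?_, fun u v => ?_, hrows⟩
    · simp [hv₁, hσ, inputMemory]
    · simp [hv₁, hσ, inputMemory]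
    · simp [hv₁, hσ, inputMemory]
    · rw [ha₁ 0 (by simp), hσ, inputMemory_adj]
  have hB₁ : indicatedSet n (σ₁.arr 2) = B := by
    rw [ha₁ 2 (by simp), hσ, indicatedSet_inputMemory 2 (by simp)]
    simp
  have hF₂ := frame_run (markComponent 2 5) σ₁
  have h5 := markComponent_run (a := 2) (m := 5) hH₁ (by simp) (by simp) (by simp)
    (by rw [hB₁]; exact (isSeparator_iff.1 hB.1).1)
  rw [hB₁] at h5
  set σ₂ := (markComponent 2 5).run σ₁
  have hv₂ : σ₂.var 4 = 0 := by
    rw [hF₂.1 4 (by simp [markComponent, markNeighbors, markNeighbor, writtenVars]),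
      hv₁ 4 (by simp) (by simp)]
    simp [hσ, inputMemory]
  have ha₂ : ∀ a, a ≠ 5 → σ₂.arr a = σ₁.arr a := fun a h5 =>
    hF₂.2 a (by simp [markComponent, markNeighbors, markNeighbor, writtenArrs, h5])
  have h₂ : Loaded G s t B A σ₂ := by
    refine ⟨hH₁.frame hF₂ (by simp [markComponent, markNeighbors, markNeighbor, writtenVars])
      (by simp [markComponent, markNeighbors, markNeighbor, writtenArrs]), ?_, ?_, h5⟩
    · rw [ha₂ 1 (by simp), ha₁ 1 (by simp), hσ, indicatedSet_inputMemory 1 (by simp)]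
      simp
    · rw [ha₂ 2 (by simp), hB₁]
  have hout : outputSequence n (appendOutput.run σ₂) = [A] := by
    rw [(appendOutput_run h₂.toHolds (by omega)).1, h₂.current, outputSequence_eq, hv₂]
    simp
  have h₃ : Loaded G s t B A (appendOutput.run σ₂) := h₂.frame (frame_run _ _)
    (by simp [appendOutput, writtenVars]) (by simp [appendOutput, writtenArrs])
  obtain ⟨S, hL, hS, hseq, hlen, hreach⟩ := slidingLoop_run h₃ hA hB hout
  generalize (loop 11 slideOnce).run (appendOutput.run σ₂) = σ₄ at *
  have hflag := decideDone_run hL.size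
  rw [hL.current, hL.goal] at hflag
  have ho : outputSequence n (decideDone.run σ₄) = outputSequence n σ₄ :=
    outputSequence_congr (run_var_eq (by simp [decideDone, writtenVars]))
      (run_arr_eq (by simp [decideDone, writtenArrs]))
  rw [ho, OutputYes, OutputNo, hflag]
  constructor
  · intro hex
    obtain rfl := hreach hex
    refine ⟨by simp, hseq, fun L' hL' => ?_⟩
    rw [slideDist_self] at hlen
    have := hL'.slideDist_lt_length
    omega
  · intro hex
    rw [if_neg]
    intro hSB
    -- The program tests containment only; for minimum separators, which have equal size, this is
    -- equality.
    obtain rfl := Finset.eq_of_subset_of_card_le hSB (hB.card_eq hS).le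
    exact hex ⟨_, hseq⟩

end TokenSliding

theorem mainTheorem5 :
    ∃ (P : RAM.Program) (p : Polynomial ℕ),
      ∀ (n : ℕ) (G : SimpleGraph (Fin n)) (s t : Fin n) (A B : Finset (Fin n)),
        TokenSliding.IsMinSeparator G s t A → TokenSliding.IsMinSeparator G s t B →
          ∃ (T : ℕ) (σ : RAM.Memory),
            RAM.Exec P (TokenSliding.inputMemory G s t A B) T σ ∧ T ≤ p.eval n ∧
            ((∃ L, TokenSliding.IsSlideSequence G s t A B L) →
              TokenSliding.OutputYes σ ∧
              TokenSliding.IsShortestSlideSequence G s t A B (TokenSliding.outputSequence n σ)) ∧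
            ((¬ ∃ L, TokenSliding.IsSlideSequence G s t A B L) → TokenSliding.OutputNo σ) := by
  obtain ⟨p, hp⟩ := TokenSliding.slidingProgram_wellFormed.exists_exec
  refine ⟨TokenSliding.slidingProgram.compile, p, fun n G s t A B hA hB => ?_⟩
  obtain ⟨T, hT, hE⟩ := hp (TokenSliding.inputMemory G s t A B)
  exact ⟨T, _, hE, hT, TokenSliding.slidingProgram_run hA hB⟩
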